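/- Let $S_n$ be the space of real symmetric $n\times n$ matrices with the Frobenius inner product $\langle X,Y\rangle=\sum_{i,j}X_{ij}Y_{ij}$, let $e_i$ be the standard basis vectors, $\mathbf 1$ the all-ones vector, $a_i=e_i-\frac1n\mathbf 1$, $\mathbb I=\{(i,j):1\le i<j\le n\}$ and $L=n(n-1)/2$. For $\alpha=(i,j)\in\mathbb I$ put $$w_\alpha=e_ie_i^\top+e_je_j^\top-e_ie_j^\top-e_je_i^\top,\qquad v_\alpha=-\tfrac12(a_ia_j^\top+a_ja_i^\top),$$ and for $1\le i\le n$ put $$w_{ii}=\tfrac12(e_i\mathbf 1^\top+\mathbf 1e_i^\top),\qquad v_{ii}=e_ie_i^\top-a_ia_i^\top.$$ Let $X^0\in S_n$ have rank $r$ and satisfy $X^0\mathbf 1=0$. Let $T_0=\{ZX^0+X^0Z^\top: Z\in\mathbb R^{n\times n}\}$ be the tangent space at $X^0$ of the manifold of symmetric matrices of rank $r$, and let $\mathcal P_{T_0}:S_n\to S_n$ be the orthogonal projection onto $T_0$. Assume that $X^0$ is $\nu$-incoherent, i.e. $$\sum_{\beta\in\mathbb I}\langle\mathcal P_{T_0}w_\alpha,w_\beta\rangle^2\le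 2\nu\frac rn\quad\text{and}\quad\sum_{\beta\in\mathbb I}\langle\mathcal P_{T_0}v_\alpha,w_\beta\rangle^2\le 4\nu\frac rn\qquad\text{for every }\alpha\in\mathbb I .$$ **Theorem (Restricted isometry property of the sampling operator).** Let $0<\epsilon\le\frac12$, let $\alpha_1,\dots,\alpha_m$ be independent and uniformly distributed on $\mathbb I$ (sampling with replacement), and define $\mathcal Q_\Omega:S_n\to S_n$ by $$\mathcal Q_\Omega(X)=\frac Lm\sum_{k=1}^m\langle X,w_{\alpha_k}\rangle v_{\alpha_k}+\sum_{i=1}^n\langle X,w_{ii}\rangle v_{ii}.$$ If $m\ge\frac{49}{\epsilon^2}\,\nu\,n\,r\log n$, then with probability at least $1-\frac2n$ $$\|\mathcal P_{T_0}\mathcal Q_\Omega\mathcal P_{T_0}-\mathcal P_{T_0}\|\le\epsilon\quad\text{and}\quad\|\mathcal P_{T_0}\mathcal Q_\Omega^{*}\mathcal P_{T_0}-\mathcal P_{T_0}\|\le\epsilon,$$ where $\|\cdot\|$ is the spectral norm of operators on $S_n$ and $\mathcal Q_\Omega^*$ is the adjoint of $\mathcal Q_\Omega$. -/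

import Mathlib

open MeasureTheory ProbabilityTheory

noncomputable section

/-- The subspace of symmetric matrices inside the real `n × n` matrices. -/
def symSubmodule (n : ℕ) : Submodule ℝ (Matrix (Fin n) (Fin n) ℝ) where
  carrier := {X | X.IsSymm}
  add_mem' hX hY := Matrix.IsSymm.add hX hY
  zero_mem' := Matrix.isSymm_zero
  smul_mem' c _ hX := Matrix.IsSymm.smul hX c

/-- The space `S_n` of real symmetric `n × n` matrices. It carries the Frobenius inner product
(declared below), so that operator norms on it are spectral norms. -/
def SymMat (n : ℕ) : Type := symSubmodule n

namespace SymMat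

variable {n : ℕ}

instance : AddCommGroup (SymMat n) := inferInstanceAs (AddCommGroup (symSubmodule n))
instance : Module ℝ (SymMat n) := inferInstanceAs (Module ℝ (symSubmodule n))
instance : FiniteDimensional ℝ (SymMat n) :=
  inferInstanceAs (FiniteDimensional ℝ (symSubmodule n))

/-- The underlying matrix. -/
def toMatrix : SymMat n →ₗ[ℝ] Matrix (Fin n) (Fin n) ℝ := (symSubmodule n).subtype

/-- A symmetric matrix as an element of `S_n`. -/
def mk (X : Matrix (Fin n) (Fin n) ℝ) (hX : X.IsSymm) : SymMat n := ⟨X, hX⟩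

@[simp] theorem toMatrix_mk (X : Matrix (Fin n) (Fin n) ℝ) (hX : X.IsSymm) :
    (mk X hX).toMatrix = X := rfl

theorem toMatrix_injective : Function.Injective (toMatrix : SymMat n → _) :=
  Subtype.val_injective

theorem isSymm (X : SymMat n) : X.toMatrix.IsSymm := X.2

/-- The Frobenius inner product `⟨X, Y⟩ = ∑ i j, X i j * Y i j`. -/
abbrev frobeniusCore (n : ℕ) : InnerProductSpace.Core ℝ (SymMat n) where
  inner X Y := ∑ i, ∑ j, X.toMatrix i j * Y.toMatrix i j
  conj_inner_symm X Y := by simp [mul_comm]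
  re_inner_nonneg X := by
    simpa using Finset.sum_nonneg fun i _ => Finset.sum_nonneg fun j _ => mul_self_nonneg _
  add_left X Y Z := by simp [add_mul, Finset.sum_add_distrib]
  smul_left X Y c := by simp [Finset.mul_sum, mul_assoc]
  definite X h := by
    apply toMatrix_injective
    ext i j
    have h1 := (Finset.sum_eq_zero_iff_of_nonneg (fun i _ => Finset.sum_nonneg
      fun j _ => mul_self_nonneg (X.toMatrix i j))).1 h i (Finset.mem_univ _)
    have h2 := (Finset.sum_eq_zero_iff_of_nonneg
      (fun j _ => mul_self_nonneg (X.toMatrix i j))).1 h1 j (Finset.mem_univ _)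
    simpa using h2

instance : NormedAddCommGroup (SymMat n) := (frobeniusCore n).toNormedAddCommGroup
instance : InnerProductSpace ℝ (SymMat n) := InnerProductSpace.ofCore (frobeniusCore n).toCore
instance : CompleteSpace (SymMat n) := FiniteDimensional.complete ℝ (SymMat n)

theorem inner_def (X Y : SymMat n) :
    inner ℝ X Y = ∑ i, ∑ j, X.toMatrix i j * Y.toMatrix i j := rfl

end SymMat

namespace EDG

variable {n : ℕ}

/-- The symmetric matrix `x yᵀ + y xᵀ`. -/
def symOuter (x y : Fin n → ℝ) : SymMat n :=
  SymMat.mk (Matrix.vecMulVec x y + Matrix.vecMulVec y x) (by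
    apply Matrix.IsSymm.ext
    intro i j
    simp only [Matrix.add_apply, Matrix.vecMulVec_apply]
    ring)

/-- Standard basis vector `e_i`. -/
def e (i : Fin n) : Fin n → ℝ := Pi.single i 1

/-- The centered basis vector `a_i = e_i - (1/n) 𝟏`. -/
def a (i : Fin n) : Fin n → ℝ := fun k => e i k - 1 / (n : ℝ)

/-- The index set `𝕀` of pairs `i < j`. -/
abbrev Pair (n : ℕ) : Type := {p : Fin n × Fin n // p.1 < p.2}

/-- `w_{ij} = e_i e_iᵀ + e_j e_jᵀ - e_i e_jᵀ - e_j e_iᵀ` for `i < j`. -/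
def w (p : Pair n) : SymMat n :=
  (1 / 2 : ℝ) • symOuter (e p.1.1) (e p.1.1) + (1 / 2 : ℝ) • symOuter (e p.1.2) (e p.1.2)
    - symOuter (e p.1.1) (e p.1.2)

/-- `w_{ii} = (e_i 𝟏ᵀ + 𝟏 e_iᵀ) / 2`. -/
def wDiag (i : Fin n) : SymMat n := (1 / 2 : ℝ) • symOuter (e i) 1

/-- `v_{ij} = -(a_i a_jᵀ + a_j a_iᵀ) / 2` for `i < j`. -/
def v (p : Pair n) : SymMat n := -((1 / 2 : ℝ) • symOuter (a p.1.1) (a p.1.2))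

/-- `v_{ii} = e_i e_iᵀ - a_i a_iᵀ`. -/
def vDiag (i : Fin n) : SymMat n :=
  (1 / 2 : ℝ) • symOuter (e i) (e i) - (1 / 2 : ℝ) • symOuter (a i) (a i)

/-- The linear map `Z ↦ Z X + X Zᵀ` from all `n × n` matrices to `S_n`. -/
def tangentMap (X : SymMat n) : Matrix (Fin n) (Fin n) ℝ →ₗ[ℝ] SymMat n where
  toFun Z := SymMat.mk (Z * X.toMatrix + X.toMatrix * Z.transpose) (by
    rw [Matrix.IsSymm, Matrix.transpose_add, Matrix.transpose_mul, Matrix.transpose_mul,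
      Matrix.transpose_transpose, X.isSymm.eq, add_comm])
  map_add' Z W := by
    apply SymMat.toMatrix_injective
    simp only [SymMat.toMatrix_mk, map_add, Matrix.transpose_add, Matrix.add_mul, Matrix.mul_add]
    abel
  map_smul' c Z := by
    apply SymMat.toMatrix_injective
    simp [smul_add]

/-- The tangent space `T_X = {Z X + X Zᵀ : Z ∈ ℝ^{n × n}}` at `X` of the manifold of symmetric
matrices whose rank is that of `X`. -/
def tangentSpace (X : SymMat n) : Submodule ℝ (SymMat n) := LinearMap.range (tangentMap X)

/-- The orthogonal projection `P_{T_X} : S_n → S_n` onto `T_X`. -/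
def tangentProj (X : SymMat n) : SymMat n →L[ℝ] SymMat n := (tangentSpace X).starProjection

/-- `X` is `ν`-incoherent with respect to `(w_α)` and its dual basis `(v_α)`, `α ∈ 𝕀`. -/
def IsIncoherent (X : SymMat n) (ν : ℝ) : Prop :=
  (∀ α : Pair n, ∑ β : Pair n, (inner ℝ (tangentProj X (w α)) (w β)) ^ 2
      ≤ 2 * ν * (X.toMatrix.rank : ℝ) / n) ∧
  (∀ α : Pair n, ∑ β : Pair n, (inner ℝ (tangentProj X (v α)) (w β)) ^ 2
      ≤ 4 * ν * (X.toMatrix.rank : ℝ) / n)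

/-- The number `L = n (n - 1) / 2` of index pairs. -/
def numPairs (n : ℕ) : ℝ := (n : ℝ) * ((n : ℝ) - 1) / 2

/-- The sampling operator of the sampled pairs `α_1, …, α_m` (with repetitions):
`Q(X) = (L / m) ∑ k, ⟨X, w_{α_k}⟩ v_{α_k} + ∑ i, ⟨X, w_{ii}⟩ v_{ii}`. -/
def samplingOp {m : ℕ} (α : Fin m → Pair n) : SymMat n →L[ℝ] SymMat n :=
  (numPairs n / (m : ℝ)) • ∑ k, (innerSL ℝ (w (α k))).smulRight (v (α k))
    + ∑ i : Fin n, (innerSL ℝ (wDiag i)).smulRight (vDiag i)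

end EDG

end

set_option linter.unusedSectionVars false

noncomputable section

open Filter Topology NormedSpace RealInnerProductSpace

namespace TraceInequality

/-! ### The Lie–Trotter product formula. -/

section Trotter

variable {𝔸 : Type*} [NormedRing 𝔸] [NormOneClass 𝔸]

/-! Write `J = I - 𝟏𝟏ᵀ/n`. The families `w`, `wDiag` and `v`, `vDiag` are dual bases: the sum of
`⟨X, w_α⟩ v_α` over all pairs is `J X J`, and the diagonal part of the sampling operator supplies `X
- J X J`. So the sampling operator has mean the identity, and its compression to the tangent space
minus `P` is the average of `m` independent centered operators
(`tangentProj_samplingOp_tangentProj_sub`). The adjoint statement concerns the adjoint of the same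
deviation, hence the same norm, and everything reduces to a matrix Bernstein inequality.

Bernstein's inequality is derived from Golden–Thompson (`tr_exp_add_le`), which splits off one
sample at a time from the trace of an exponential. Golden–Thompson itself follows from trace
inequalities for powers `2 ^ k` and the Trotter formula. The summands are not self-adjoint, so their
self-adjoint dilations are used. Since the samples are uniform on a finite set, expectations are
sums over all `m`-tuples and probabilities are cardinalities.

The remaining input is a norm bound `2 K n` and a variance bound `6 K n`, in both orders of
multiplication, with `K = ν r`. Let `Q` be the orthogonal projection onto the range of `X₀`. The
identity `sum_inner_w_sq` converts the incoherence bound on `∑ ⟨P w_α, w_β⟩²` into `‖P w_α‖² ≤ K /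
n` and into the leverage bound `Q i i ≤ √(2 K) / n`. The leverage scores in turn control `‖P v_α‖`
and the diagonals of tangent vectors, hence `∑ ⟨P Y, w_α⟩²`. With `θ = ε / (7 K n)` the exponential
factor is at most `n⁻³`, against a dimension factor of at most `2 n²`. -/

theorem norm_pow_sub_pow_le {X Y : 𝔸} {c : ℝ} (hc : 1 ≤ c) (hX : ‖X‖ ≤ c) (hY : ‖Y‖ ≤ c) (k : ℕ) :
    ‖X ^ k - Y ^ k‖ ≤ k * c ^ k * ‖X - Y‖ := by
  induction k with
  | zero => simp
  | succ k ih =>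
    have h : X ^ (k + 1) - Y ^ (k + 1) = X ^ k * (X - Y) + (X ^ k - Y ^ k) * Y := by
      rw [pow_succ, pow_succ]; noncomm_ring
    have h1 : ‖X ^ k * (X - Y)‖ ≤ c ^ (k + 1) * ‖X - Y‖ := by
      refine (norm_mul_le _ _).trans ?_
      gcongr
      calc ‖X ^ k‖ ≤ ‖X‖ ^ k := norm_pow_le _ _
        _ ≤ c ^ k := by gcongr
        _ ≤ c ^ (k + 1) := pow_le_pow_right₀ hc (Nat.le_succ k)
    have h2 : ‖(X ^ k - Y ^ k) * Y‖ ≤ k * c ^ k * ‖X - Y‖ * c := by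
      refine (norm_mul_le _ _).trans ?_
      gcongr
    rw [h]
    refine (norm_add_le _ _).trans ((add_le_add h1 h2).trans (le_of_eq ?_))
    push_cast; ring

variable [NormedAlgebra ℝ 𝔸] [CompleteSpace 𝔸]

theorem norm_exp_le_exp_norm (A : 𝔸) : ‖exp A‖ ≤ Real.exp ‖A‖ := by
  have h := exp_series_hasSum_exp' (𝕂 := ℝ) A
  have h2 : HasSum (fun n : ℕ => ((n.factorial : ℝ))⁻¹ • ‖A‖ ^ n) (Real.exp ‖A‖) := by
    rw [Real.exp_eq_exp_ℝ]; exact exp_series_hasSum_exp' (𝕂 := ℝ) ‖A‖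
  rw [← h.tsum_eq, ← h2.tsum_eq]
  refine tsum_of_norm_bounded h2.summable.hasSum fun n => ?_
  rw [norm_smul, smul_eq_mul, norm_inv, Real.norm_natCast]
  gcongr
  exact norm_pow_le _ _

/-- Both curves pass through `1` at `t = 0` with the same derivative `A + B`. -/
theorem exp_smul_mul_exp_smul_sub_isLittleO (A B : 𝔸) :
    (fun t : ℝ => exp (t • A) * exp (t • B) - exp (t • (A + B))) =o[𝓝 0] fun t : ℝ => t := by
  have h := (((hasDerivAt_exp_smul_const (𝕂 := ℝ) A (0 : ℝ)).mul
    (hasDerivAt_exp_smul_const (𝕂 := ℝ) B (0 : ℝ))).sub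
    (hasDerivAt_exp_smul_const (𝕂 := ℝ) (A + B) (0 : ℝ))).isLittleO
  simpa using h

/-- One factor is off by `o(1/N)`. Taking `N`-th powers multiplies the error by at most `N * exp
(‖A‖ + ‖B‖)`, because both bases have norm at most `exp ((‖A‖ + ‖B‖) / N)`. -/
theorem tendsto_trotter (A B : 𝔸) :
    Tendsto (fun N : ℕ => (exp ((N : ℝ)⁻¹ • A) * exp ((N : ℝ)⁻¹ • B)) ^ N) atTop
      (𝓝 (exp (A + B))) := by
  have hlim : Tendsto (fun N : ℕ => (N : ℝ) *
      ‖exp ((N : ℝ)⁻¹ • A) * exp ((N : ℝ)⁻¹ • B) - exp ((N : ℝ)⁻¹ • (A + B))‖) atTop (𝓝 0) := by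
    have h := ((exp_smul_mul_exp_smul_sub_isLittleO A B).comp_tendsto
      (tendsto_inv_atTop_nhds_zero_nat (𝕜 := ℝ))).norm_left.tendsto_div_nhds_zero
    refine h.congr fun N => ?_
    simp [div_eq_mul_inv, mul_comm]
  rw [tendsto_iff_norm_sub_tendsto_zero]
  set C := Real.exp (‖A‖ + ‖B‖)
  have hC : Tendsto (fun N : ℕ => C * ((N : ℝ) *
      ‖exp ((N : ℝ)⁻¹ • A) * exp ((N : ℝ)⁻¹ • B) - exp ((N : ℝ)⁻¹ • (A + B))‖)) atTop (𝓝 0) := by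
    simpa using hlim.const_mul C
  refine squeeze_zero' (Eventually.of_forall fun _ => norm_nonneg _) ?_ hC
  filter_upwards [eventually_gt_atTop 0] with N hN
  have hN' : (0 : ℝ) < N := by exact_mod_cast hN
  let _ : NormedAlgebra ℚ 𝔸 := NormedAlgebra.restrictScalars ℚ ℝ 𝔸
  have hpow : exp (A + B) = exp ((N : ℝ)⁻¹ • (A + B)) ^ N := by
    rw [← exp_nsmul, ← Nat.cast_smul_eq_nsmul ℝ, smul_smul, mul_inv_cancel₀ hN'.ne', one_smul]
  set c := Real.exp ((N : ℝ)⁻¹ * (‖A‖ + ‖B‖))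
  have hns : ∀ Z : 𝔸, ‖(N : ℝ)⁻¹ • Z‖ = (N : ℝ)⁻¹ * ‖Z‖ := fun Z => by
    rw [norm_smul, norm_inv, Real.norm_natCast]
  have h1 : ‖exp ((N : ℝ)⁻¹ • A) * exp ((N : ℝ)⁻¹ • B)‖ ≤ c := by
    refine (norm_mul_le _ _).trans ((mul_le_mul (norm_exp_le_exp_norm _) (norm_exp_le_exp_norm _)
      (norm_nonneg _) (Real.exp_pos _).le).trans (le_of_eq ?_))
    rw [← Real.exp_add, hns, hns, ← mul_add]
  have h2 : ‖exp ((N : ℝ)⁻¹ • (A + B))‖ ≤ c := by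
    refine (norm_exp_le_exp_norm _).trans (Real.exp_le_exp.2 ?_)
    rw [hns]
    gcongr
    exact norm_add_le _ _
  have hc : 1 ≤ c := Real.one_le_exp (by positivity)
  have hcN : c ^ N = C := by
    rw [← Real.exp_nat_mul, ← mul_assoc, mul_inv_cancel₀ hN'.ne', one_mul]
  calc _ = ‖(exp ((N : ℝ)⁻¹ • A) * exp ((N : ℝ)⁻¹ • B)) ^ N - exp ((N : ℝ)⁻¹ • (A + B)) ^ N‖ := by
        rw [hpow]
    _ ≤ _ := norm_pow_sub_pow_le hc h1 h2 N
    _ = _ := by rw [hcN]; ring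

end Trotter

/-! ### Trace inequalities and Golden–Thompson. -/

variable {E : Type*} [NormedAddCommGroup E] [InnerProductSpace ℝ E] [FiniteDimensional ℝ E]

/-- The trace of an operator on a finite-dimensional inner product space. -/
def tr : (E →L[ℝ] E) →ₗ[ℝ] ℝ :=
  LinearMap.trace ℝ E ∘ₗ ContinuousLinearMap.coeLM ℝ

theorem tr_mul_comm (A B : E →L[ℝ] E) : tr (A * B) = tr (B * A) :=
  LinearMap.trace_mul_comm ℝ (A : E →ₗ[ℝ] E) (B : E →ₗ[ℝ] E)

theorem tr_eq_sum {ι : Type*} [Fintype ι] (b : OrthonormalBasis ι ℝ E) (A : E →L[ℝ] E) :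
    tr A = ∑ i, ⟪b i, A (b i)⟫ :=
  LinearMap.trace_eq_sum_inner (A : E →ₗ[ℝ] E) b

theorem tr_one : tr (1 : E →L[ℝ] E) = Module.finrank ℝ E := LinearMap.trace_one ℝ E

theorem continuous_tr : Continuous (tr : (E →L[ℝ] E) →ₗ[ℝ] ℝ) :=
  LinearMap.continuous_of_finiteDimensional _

variable [CompleteSpace E]

theorem inner_star_apply (A : E →L[ℝ] E) (x y : E) : ⟪x, star A y⟫ = ⟪A x, y⟫ :=
  ContinuousLinearMap.adjoint_inner_right A x y

theorem IsSelfAdjoint.inner_apply {A : E →L[ℝ] E} (hA : IsSelfAdjoint A) (x y : E) :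
    ⟪x, A y⟫ = ⟪A x, y⟫ := by
  rw [← inner_star_apply, hA.star_eq]

theorem tr_star (A : E →L[ℝ] E) : tr (star A) = tr A := by
  rw [tr_eq_sum (stdOrthonormalBasis ℝ E), tr_eq_sum (stdOrthonormalBasis ℝ E)]
  exact Finset.sum_congr rfl fun i _ => by rw [inner_star_apply, real_inner_comm]

theorem tr_star_mul_self_nonneg (A : E →L[ℝ] E) : 0 ≤ tr (star A * A) := by
  rw [tr_eq_sum (stdOrthonormalBasis ℝ E)]
  refine Finset.sum_nonneg fun i _ => ?_
  rw [mul_apply_eq_comp, inner_star_apply]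
  exact real_inner_self_nonneg

/-- Expand the nonnegative squared Hilbert–Schmidt norm of `star A - B`. -/
theorem two_mul_tr_mul_le (A B : E →L[ℝ] E) :
    2 * tr (A * B) ≤ tr (A * star A) + tr (star B * B) := by
  have h := tr_star_mul_self_nonneg (star A - B)
  have h1 : star (star A - B) * (star A - B) =
      A * star A - A * B - star (A * B) + star B * B := by
    rw [star_sub, star_star, star_mul]; noncomm_ring
  rw [h1] at h
  simp only [map_add, map_sub, tr_star] at h
  linarith

theorem tr_sq_le (M : E →L[ℝ] E) : tr (M ^ 2) ≤ tr (M * star M) := by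
  have h := two_mul_tr_mul_le M M
  rw [tr_mul_comm (star M)] at h
  rw [pow_two]; linarith

theorem tr_mul_pow_comm (A B : E →L[ℝ] E) (k : ℕ) : tr ((A * B) ^ k) = tr ((B * A) ^ k) := by
  cases k with
  | zero => simp
  | succ k =>
    have h : (A * B) ^ (k + 1) = A * (B * A) ^ k * B := by
      induction k with
      | zero => simp
      | succ k ih => rw [pow_succ, ih, pow_succ (B * A)]; noncomm_ring
    rw [h, tr_mul_comm, ← mul_assoc, ← pow_succ']

/-- The two claims need a joint induction. The first at `k + 1` is the second at `k` applied to `A *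
B`, then cyclicity, then the first at `k` for `A ^ 2` and `B ^ 2`. The second at `k + 1` applies the
second at `k` to `M ^ 2`, then the first to `star M * M` and `M * star M`. Cauchy–Schwarz finishes,
since these two products have equal power traces. -/
theorem tr_pow_two_pow_le (k : ℕ) :
    (∀ A B : E →L[ℝ] E, IsSelfAdjoint A → IsSelfAdjoint B →
      tr ((A * B) ^ 2 ^ k) ≤ tr (A ^ 2 ^ k * B ^ 2 ^ k)) ∧
    (∀ M : E →L[ℝ] E, tr (M ^ 2 ^ (k + 1)) ≤ tr ((M * star M) ^ 2 ^ k)) := by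
  induction k with
  | zero => exact ⟨fun A B _ _ => by simp, fun M => by simpa using tr_sq_le M⟩
  | succ k ih =>
    obtain ⟨hP, hL⟩ := ih
    refine ⟨fun A B hA hB => ?_, fun M => ?_⟩
    · calc tr ((A * B) ^ 2 ^ (k + 1)) ≤ tr ((A * B * star (A * B)) ^ 2 ^ k) := hL _
        _ = tr ((A * (B * B * A)) ^ 2 ^ k) := by
            rw [star_mul, hA.star_eq, hB.star_eq]; simp only [mul_assoc]
        _ = tr (((B ^ 2) * (A ^ 2)) ^ 2 ^ k) := by
            rw [tr_mul_pow_comm, pow_two, pow_two]; simp only [mul_assoc]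
        _ = tr (((A ^ 2) * (B ^ 2)) ^ 2 ^ k) := tr_mul_pow_comm _ _ _
        _ ≤ tr ((A ^ 2) ^ 2 ^ k * (B ^ 2) ^ 2 ^ k) := hP _ _ (hA.pow 2) (hB.pow 2)
        _ = _ := by rw [← pow_mul, ← pow_mul, ← pow_succ']
    · have hS : IsSelfAdjoint (star M * M) := IsSelfAdjoint.star_mul_self M
      have hT : IsSelfAdjoint (M * star M) := IsSelfAdjoint.mul_star_self M
      have hcs := two_mul_tr_mul_le ((star M * M) ^ 2 ^ k) ((M * star M) ^ 2 ^ k)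
      rw [(hS.pow _).star_eq, (hT.pow _).star_eq, ← pow_add, ← pow_add, ← two_mul,
        ← pow_succ', tr_mul_pow_comm (star M)] at hcs
      calc tr (M ^ 2 ^ (k + 1 + 1)) = tr ((M ^ 2) ^ 2 ^ (k + 1)) := by
            rw [← pow_mul, ← pow_succ']
        _ ≤ tr ((M ^ 2 * star (M ^ 2)) ^ 2 ^ k) := hL _
        _ = tr ((M * (M * star M * star M)) ^ 2 ^ k) := by
            rw [pow_two, star_mul]; simp only [mul_assoc]
        _ = tr (((M * star M) * (star M * M)) ^ 2 ^ k) := by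
            rw [tr_mul_pow_comm]; simp only [mul_assoc]
        _ = tr (((star M * M) * (M * star M)) ^ 2 ^ k) := tr_mul_pow_comm _ _ _
        _ ≤ tr ((star M * M) ^ 2 ^ k * (M * star M) ^ 2 ^ k) := hP _ _ hS hT
        _ ≤ _ := by linarith

theorem IsSelfAdjoint.exp_clm {A : E →L[ℝ] E} (hA : IsSelfAdjoint A) : IsSelfAdjoint (exp A) := by
  let _ : NormedAlgebra ℚ (E →L[ℝ] E) := NormedAlgebra.restrictScalars ℚ ℝ _
  rw [isSelfAdjoint_iff, star_exp, hA.star_eq]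

/-- The Golden–Thompson inequality. -/
theorem tr_exp_add_le [Nontrivial E] {A B : E →L[ℝ] E} (hA : IsSelfAdjoint A)
    (hB : IsSelfAdjoint B) : tr (exp (A + B)) ≤ tr (exp A * exp B) := by
  -- Only the subsequence `N = 2 ^ k` of the Trotter limit is used, as the power inequality is
  -- available only for such exponents.
  have h := (continuous_tr.tendsto _).comp ((tendsto_trotter A B).comp
    (tendsto_pow_atTop_atTop_of_one_lt (one_lt_two : (1 : ℕ) < 2)))
  refine le_of_tendsto h (Eventually.of_forall fun k => ?_)
  let _ : NormedAlgebra ℚ (E →L[ℝ] E) := NormedAlgebra.restrictScalars ℚ ℝ _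
  have hpow : ∀ Z : E →L[ℝ] E, exp (((2 ^ k : ℕ) : ℝ)⁻¹ • Z) ^ 2 ^ k = exp Z := fun Z => by
    rw [← exp_nsmul, ← Nat.cast_smul_eq_nsmul ℝ, smul_smul, mul_inv_cancel₀ (by positivity),
      one_smul]
  have := (tr_pow_two_pow_le k).1 (exp (((2 ^ k : ℕ) : ℝ)⁻¹ • A)) (exp (((2 ^ k : ℕ) : ℝ)⁻¹ • B))
    (IsSelfAdjoint.exp_clm ((IsSelfAdjoint.all _).smul hA))
    (IsSelfAdjoint.exp_clm ((IsSelfAdjoint.all _).smul hB))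
  rwa [hpow, hpow] at this

theorem exists_exp_eq_mul_self {H : E →L[ℝ] E} (hH : IsSelfAdjoint H) :
    ∃ N : E →L[ℝ] E, IsSelfAdjoint N ∧ exp H = N * N := by
  let _ : NormedAlgebra ℚ (E →L[ℝ] E) := NormedAlgebra.restrictScalars ℚ ℝ _
  refine ⟨exp ((2 : ℝ)⁻¹ • H), IsSelfAdjoint.exp_clm ((IsSelfAdjoint.all _).smul hH), ?_⟩
  rw [← exp_add_of_commute (Commute.refl _), ← add_smul]
  norm_num

/-- With `N = exp (H / 2)` the trace is `∑ ⟪N b_i, M (N b_i)⟫`, so a bound on the quadratic form of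
`M` suffices; `M` need not be self-adjoint. -/
theorem tr_exp_mul_le {H M : E →L[ℝ] E} (hH : IsSelfAdjoint H) {c : ℝ}
    (hM : ∀ x, ⟪x, M x⟫ ≤ c * ‖x‖ ^ 2) : tr (exp H * M) ≤ c * tr (exp H) := by
  obtain ⟨N, hN, h⟩ := exists_exp_eq_mul_self hH
  rw [h, mul_assoc, tr_mul_comm, tr_eq_sum (stdOrthonormalBasis ℝ E),
    tr_eq_sum (stdOrthonormalBasis ℝ E), Finset.mul_sum]
  refine Finset.sum_le_sum fun i _ => ?_
  simp only [mul_apply_eq_comp]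
  rw [IsSelfAdjoint.inner_apply hN, IsSelfAdjoint.inner_apply hN, real_inner_self_eq_norm_sq]
  exact hM _

/-- With `N = exp (H / 2)` the left side is `‖N x‖ ^ 2`, which is at most the squared
Hilbert–Schmidt norm of `N`. -/
theorem inner_exp_le_tr {H : E →L[ℝ] E} (hH : IsSelfAdjoint H) {x : E} (hx : ‖x‖ = 1) :
    ⟪x, exp H x⟫ ≤ tr (exp H) := by
  obtain ⟨N, hN, h⟩ := exists_exp_eq_mul_self hH
  let b := stdOrthonormalBasis ℝ E
  rw [h, tr_eq_sum b, mul_apply_eq_comp, IsSelfAdjoint.inner_apply hN,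
    real_inner_self_eq_norm_sq, ← b.sum_sq_norm_inner_right]
  refine Finset.sum_le_sum fun i _ => ?_
  rw [mul_apply_eq_comp, IsSelfAdjoint.inner_apply hN,
    IsSelfAdjoint.inner_apply hN, real_inner_self_eq_norm_sq, Real.norm_eq_abs, sq_abs]
  have := abs_real_inner_le_norm (N (b i)) x
  rw [hx, mul_one] at this
  exact sq_le_sq' (by linarith [neg_abs_le ⟪N (b i), x⟫]) ((le_abs_self _).trans this)

theorem exp_apply_eigenvector {H : E →L[ℝ] E} {x : E} {c : ℝ} (h : H x = c • x) :
    exp H x = Real.exp c • x := by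
  have h1 := (exp_series_hasSum_exp' (𝕂 := ℝ) H).mapL (ContinuousLinearMap.apply ℝ E x)
  have h2 : HasSum (fun n : ℕ => (((n.factorial : ℝ))⁻¹ • c ^ n) • x) (Real.exp c • x) := by
    rw [Real.exp_eq_exp_ℝ]; exact (exp_series_hasSum_exp' (𝕂 := ℝ) c).smul_const x
  have hp : ∀ n : ℕ, (H ^ n) x = c ^ n • x := fun n => by
    induction n with
    | zero => simp
    | succ n ih =>
      rw [pow_succ, mul_apply_eq_comp, h, map_smul, ih, smul_smul, pow_succ']
  refine h1.unique (h2.congr_fun ?_)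
  intro n
  simp [hp, smul_smul]

/-- The trace exponential dominates the exponential of every Rayleigh quotient. -/
theorem exp_rayleigh_le_tr_exp {H : E →L[ℝ] E} (hH : IsSelfAdjoint H) {x : E} (hx : x ≠ 0) {c : ℝ}
    (hc : c * ‖x‖ ^ 2 ≤ ⟪H x, x⟫) : Real.exp c ≤ tr (exp H) := by
  have : Nontrivial E := ⟨x, 0, hx⟩
  have hS : (H : E →ₗ[ℝ] E).IsSymmetric := fun y z => (IsSelfAdjoint.inner_apply hH y z).symm
  -- The supremum `q` of the Rayleigh quotients is an eigenvalue, so `exp q` is a value of the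
  -- quadratic form of `exp H` at a unit vector.
  obtain ⟨y, hy⟩ := hS.hasEigenvalue_iSup_of_finiteDimensional.exists_hasEigenvector
  set q := ⨆ x : { x : E // x ≠ 0 }, RCLike.re ⟪(H : E →ₗ[ℝ] E) x, x⟫ / ‖(x : E)‖ ^ 2
  have hbdd : BddAbove (Set.range fun x : { x : E // x ≠ 0 } =>
      RCLike.re ⟪(H : E →ₗ[ℝ] E) x, x⟫ / ‖(x : E)‖ ^ 2) := by
    refine ⟨‖H‖, ?_⟩
    rintro _ ⟨z, rfl⟩
    have hz : 0 < ‖(z : E)‖ := norm_pos_iff.2 z.2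
    rw [div_le_iff₀ (by positivity)]
    calc ⟪H (z : E), (z : E)⟫ ≤ ‖H (z : E)‖ * ‖(z : E)‖ := real_inner_le_norm _ _
      _ ≤ ‖H‖ * ‖(z : E)‖ * ‖(z : E)‖ := by gcongr; exact H.le_opNorm _
      _ = _ := by ring
  have hq : c ≤ q := by
    have hx' : 0 < ‖x‖ := norm_pos_iff.2 hx
    refine le_trans ?_ (le_ciSup hbdd ⟨x, hx⟩)
    rw [le_div_iff₀ (by positivity)]
    exact hc
  have hy0 : 0 < ‖y‖ := norm_pos_iff.2 hy.2
  have hHy : H (‖y‖⁻¹ • y) = q • (‖y‖⁻¹ • y) := by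
    rw [map_smul, smul_comm]
    congr 1
    exact hy.apply_eq_smul
  have hn : ‖‖y‖⁻¹ • y‖ = 1 := by
    rw [norm_smul, norm_inv, norm_norm, inv_mul_cancel₀ hy0.ne']
  have := inner_exp_le_tr hH hn
  rw [exp_apply_eigenvector hHy, real_inner_smul_right, real_inner_self_eq_norm_sq, hn] at this
  exact (Real.exp_le_exp.2 hq).trans (by simpa using this)

/-- Second-order Taylor bound: `(n + 2)! ≥ 2 * n!`, and `⟪x, X ^ (n + 2) x⟫ ≤ R ^ n * ‖X x‖ ^ 2`, so
the tail is dominated termwise by the series of `exp R`. -/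
theorem inner_exp_le [Nontrivial E] {X : E →L[ℝ] E} (hX : IsSelfAdjoint X) {R : ℝ} (hR : ‖X‖ ≤ R)
    (x : E) : ⟪x, exp X x⟫ ≤ ‖x‖ ^ 2 + ⟪x, X x⟫ + Real.exp R / 2 * ‖X x‖ ^ 2 := by
  have hR0 : 0 ≤ R := (norm_nonneg _).trans hR
  have h1 := ((exp_series_hasSum_exp' (𝕂 := ℝ) X).mapL (ContinuousLinearMap.apply ℝ E x)).mapL
    (innerSL ℝ x)
  have h2 : HasSum (fun n : ℕ => R ^ n / n.factorial) (Real.exp R) := by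
    rw [Real.exp_eq_exp_ℝ]; exact expSeries_div_hasSum_exp R
  have h3 := (hasSum_nat_add_iff' 2).2 h1
  have h4 := h2.mul_right (‖X x‖ ^ 2 / 2)
  have hle := hasSum_le (fun n => ?_) h3 h4
  · simp [Finset.sum_range_succ] at hle
    exact hle.trans (le_of_eq (by ring))
  · have hterm : ⟪x, (X ^ (n + 2)) x⟫ ≤ R ^ n * ‖X x‖ ^ 2 := by
      rw [pow_succ, pow_succ', mul_apply_eq_comp,
        mul_apply_eq_comp, IsSelfAdjoint.inner_apply hX]
      calc _ ≤ ‖X x‖ * ‖(X ^ n) (X x)‖ := real_inner_le_norm _ _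
        _ ≤ ‖X x‖ * (R ^ n * ‖X x‖) := by
          gcongr
          refine ((X ^ n).le_opNorm _).trans ?_
          gcongr
          exact (norm_pow_le X n).trans (by gcongr)
        _ = _ := by ring
    have hf : (2 : ℝ) * n.factorial ≤ (n + 2).factorial := by
      have : 2 * n.factorial ≤ (n + 2).factorial := by
        rw [Nat.factorial_succ, Nat.factorial_succ, ← mul_assoc]
        exact Nat.mul_le_mul_right _ (by nlinarith)
      exact_mod_cast this
    have hfp : (0 : ℝ) < n.factorial := by exact_mod_cast Nat.factorial_pos n
    simp only [map_smul, ContinuousLinearMap.apply_apply, innerSL_apply_apply, smul_eq_mul]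
    calc _ ≤ ((n + 2).factorial : ℝ)⁻¹ * (R ^ n * ‖X x‖ ^ 2) := by gcongr
      _ ≤ (2 * n.factorial : ℝ)⁻¹ * (R ^ n * ‖X x‖ ^ 2) := by gcongr
      _ = _ := by field_simp

/-! ### Matrix Laplace transform, dilations and Bernstein's inequality. -/

variable {κ : Type*} [Fintype κ]

theorem sum_tr_exp_add_le [Nontrivial E] {X : κ → E →L[ℝ] E} (hX : ∀ a, IsSelfAdjoint (X a)) {c : ℝ}
    (hc : ∀ x, ∑ a, ⟪x, exp (X a) x⟫ ≤ c * ‖x‖ ^ 2) {H : E →L[ℝ] E} (hH : IsSelfAdjoint H) :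
    ∑ a, tr (exp (H + X a)) ≤ c * tr (exp H) := by
  calc ∑ a, tr (exp (H + X a)) ≤ ∑ a, tr (exp H * exp (X a)) :=
        Finset.sum_le_sum fun a _ => tr_exp_add_le hH (hX a)
    _ = tr (exp H * ∑ a, exp (X a)) := by rw [Finset.mul_sum, map_sum]
    _ ≤ _ := tr_exp_mul_le hH fun x => by
        rw [sum_apply, inner_sum]; exact hc x

/-- Averaging over one sample with the others frozen costs a factor `c`; with no samples left, the
trace of `exp 0` is the dimension. -/
theorem sum_tr_exp_sum_le [Nontrivial E] {X : κ → E →L[ℝ] E} (hX : ∀ a, IsSelfAdjoint (X a)) {c : ℝ}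
    (hc0 : 0 ≤ c) (hc : ∀ x, ∑ a, ⟪x, exp (X a) x⟫ ≤ c * ‖x‖ ^ 2) (m : ℕ) :
    ∑ α : Fin m → κ, tr (exp (∑ k, X (α k))) ≤ c ^ m * Module.finrank ℝ E := by
  induction m with
  | zero => simp [tr_one]
  | succ m ih =>
    rw [← (Fin.consEquiv fun _ : Fin (m + 1) => κ).sum_comp, Fintype.sum_prod_type_right]
    calc _ = ∑ α : Fin m → κ, ∑ a, tr (exp (∑ k, X (α k) + X a)) := by
          simp [Fin.sum_univ_succ, add_comm]
      _ ≤ ∑ α : Fin m → κ, c * tr (exp (∑ k, X (α k))) :=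
          Finset.sum_le_sum fun α _ => sum_tr_exp_add_le hX hc
            (isSelfAdjoint_sum _ fun k _ => hX _)
      _ = c * ∑ α : Fin m → κ, tr (exp (∑ k, X (α k))) := by rw [Finset.mul_sum]
      _ ≤ c * (c ^ m * Module.finrank ℝ E) := by gcongr
      _ = _ := by ring

/-- Moment generating function bound for the sums of `m` independent uniform samples from a finite
centered family of self-adjoint operators. -/
theorem sum_tr_exp_smul_sum_le [Nontrivial E] {X : κ → E →L[ℝ] E} (hX : ∀ a, IsSelfAdjoint (X a))
    (hsum : ∑ a, X a = 0) {R V θ : ℝ} (hθ : 0 ≤ θ) (hR : ∀ a, ‖X a‖ ≤ R)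
    (hV : ∀ x, ∑ a, ‖X a x‖ ^ 2 ≤ Fintype.card κ * V * ‖x‖ ^ 2) (m : ℕ) :
    ∑ α : Fin m → κ, tr (exp (θ • ∑ k, X (α k))) ≤
      (Fintype.card κ * Real.exp (θ ^ 2 * V * Real.exp (θ * R) / 2)) ^ m *
        Module.finrank ℝ E := by
  simp only [Finset.smul_sum]
  refine sum_tr_exp_sum_le (X := fun a => θ • X a)
    (fun a => (IsSelfAdjoint.all θ).smul (hX a)) (by positivity) (fun x => ?_) m
  have h1 : ∀ a, ⟪x, exp (θ • X a) x⟫ ≤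
      ‖x‖ ^ 2 + ⟪x, (θ • X a) x⟫ + Real.exp (θ * R) / 2 * ‖(θ • X a) x‖ ^ 2 := fun a =>
    inner_exp_le ((IsSelfAdjoint.all θ).smul (hX a))
      (by rw [norm_smul, Real.norm_of_nonneg hθ]; gcongr; exact hR a) x
  -- Centering removes the linear term, leaving only the variance term in the exponent.
  have h2 : ∑ a, ⟪x, (θ • X a) x⟫ = 0 := by
    rw [← inner_sum, ← sum_apply, ← Finset.smul_sum, hsum]
    simp
  have h3 : ∑ a, ‖(θ • X a) x‖ ^ 2 = θ ^ 2 * ∑ a, ‖X a x‖ ^ 2 := by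
    rw [Finset.mul_sum]
    refine Finset.sum_congr rfl fun a _ => ?_
    rw [smul_apply, norm_smul, mul_pow, Real.norm_eq_abs, sq_abs]
  calc ∑ a, ⟪x, exp (θ • X a) x⟫ ≤ ∑ a, (‖x‖ ^ 2 + ⟪x, (θ • X a) x⟫ +
        Real.exp (θ * R) / 2 * ‖(θ • X a) x‖ ^ 2) := Finset.sum_le_sum fun a _ => h1 a
    _ = Fintype.card κ * ‖x‖ ^ 2 + Real.exp (θ * R) / 2 * (θ ^ 2 * ∑ a, ‖X a x‖ ^ 2) := by
      rw [Finset.sum_add_distrib, Finset.sum_add_distrib, h2, ← Finset.mul_sum, h3]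
      simp
    _ ≤ Fintype.card κ * ‖x‖ ^ 2 +
        Real.exp (θ * R) / 2 * (θ ^ 2 * (Fintype.card κ * V * ‖x‖ ^ 2)) := by
      gcongr; exact hV x
    _ = Fintype.card κ * (θ ^ 2 * V * Real.exp (θ * R) / 2 + 1) * ‖x‖ ^ 2 := by ring
    _ ≤ _ := by gcongr; exact Real.add_one_le_exp _

/-- The self-adjoint dilation `(x, y) ↦ (B y, B* x)`. -/
def dilation (B : E →L[ℝ] E) : WithLp 2 (E × E) →L[ℝ] WithLp 2 (E × E) :=
  LinearMap.toContinuousLinearMap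
    { toFun := fun z => WithLp.toLp 2 (B z.snd, star B z.fst)
      map_add' := fun z w => by simp [← WithLp.toLp_add]
      map_smul' := fun c z => by simp [← WithLp.toLp_smul] }

theorem dilation_apply (B : E →L[ℝ] E) (z : WithLp 2 (E × E)) :
    dilation B z = WithLp.toLp 2 (B z.snd, star B z.fst) := rfl

theorem dilation_zero : dilation (0 : E →L[ℝ] E) = 0 := by
  ext1 z
  rw [dilation_apply]
  simp only [star_zero, zero_apply]
  rfl

theorem dilation_add (A B : E →L[ℝ] E) : dilation (A + B) = dilation A + dilation B := by
  ext1 z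
  rw [add_apply, dilation_apply, dilation_apply, dilation_apply, star_add, ← WithLp.toLp_add]
  rfl

theorem dilation_sum {ι : Type*} (s : Finset ι) (B : ι → E →L[ℝ] E) :
    ∑ i ∈ s, dilation (B i) = dilation (∑ i ∈ s, B i) :=
  (map_sum (AddMonoidHom.mk' (dilation (E := E)) dilation_add) B s).symm

theorem inner_dilation_apply (B : E →L[ℝ] E) (z w : WithLp 2 (E × E)) :
    ⟪dilation B z, w⟫ = ⟪B z.snd, w.fst⟫ + ⟪z.fst, B w.snd⟫ := by
  rw [WithLp.prod_inner_apply]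
  change ⟪B z.snd, w.fst⟫ + ⟪star B z.fst, w.snd⟫ = _
  rw [real_inner_comm w.snd, inner_star_apply, real_inner_comm z.fst]

theorem isSelfAdjoint_dilation (B : E →L[ℝ] E) : IsSelfAdjoint (dilation B) := by
  rw [ContinuousLinearMap.isSelfAdjoint_iff_isSymmetric]
  intro z w
  change ⟪dilation B z, w⟫ = ⟪z, dilation B w⟫
  rw [real_inner_comm (dilation B w), inner_dilation_apply, inner_dilation_apply,
    real_inner_comm w.fst, real_inner_comm (B w.snd)]
  ring

theorem norm_dilation_apply_sq (B : E →L[ℝ] E) (z : WithLp 2 (E × E)) :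
    ‖dilation B z‖ ^ 2 = ‖B z.snd‖ ^ 2 + ‖star B z.fst‖ ^ 2 := by
  rw [WithLp.prod_norm_sq_eq_of_L2]; rfl

theorem norm_dilation_le (B : E →L[ℝ] E) : ‖dilation B‖ ≤ ‖B‖ := by
  refine ContinuousLinearMap.opNorm_le_bound _ (norm_nonneg _) fun z => ?_
  refine le_of_sq_le_sq ?_ (by positivity)
  rw [norm_dilation_apply_sq, mul_pow, WithLp.prod_norm_sq_eq_of_L2]
  have h1 : ‖B z.snd‖ ^ 2 ≤ (‖B‖ * ‖z.snd‖) ^ 2 := by gcongr; exact B.le_opNorm _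
  have h2 : ‖star B z.fst‖ ^ 2 ≤ (‖B‖ * ‖z.fst‖) ^ 2 := by
    gcongr; rw [← norm_star B]; exact (star B).le_opNorm _
  nlinarith

/-- If `‖B y‖ > t * ‖y‖`, rescale `B y` to the length of `y`. The pair `(‖y‖ / ‖B y‖ • B y, y)` then
has Rayleigh quotient `‖B y‖ / ‖y‖ > t` for the dilation. -/
theorem exp_le_tr_exp_dilation {B : E →L[ℝ] E} {θ t : ℝ} (hθ : 0 ≤ θ) (ht : 0 ≤ t)
    (h : t < ‖B‖) : Real.exp (θ * t) ≤ tr (exp (θ • dilation B)) := by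
  obtain ⟨y, hy⟩ : ∃ y, t * ‖y‖ < ‖B y‖ := by
    by_contra! hcon
    exact absurd (B.opNorm_le_bound ht hcon) (not_le.2 h)
  have hBy : 0 < ‖B y‖ := lt_of_le_of_lt (by positivity) hy
  have hy0 : 0 < ‖y‖ := by
    rw [norm_pos_iff]; rintro rfl; simp at hBy
  set z : WithLp 2 (E × E) := WithLp.toLp 2 ((‖y‖ / ‖B y‖) • B y, y)
  have hz1 : ‖z‖ ^ 2 = 2 * ‖y‖ ^ 2 := by
    rw [WithLp.prod_norm_sq_eq_of_L2]
    change ‖(‖y‖ / ‖B y‖) • B y‖ ^ 2 + ‖y‖ ^ 2 = _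
    rw [norm_smul, norm_div, norm_norm, norm_norm, div_mul_cancel₀ _ hBy.ne']
    ring
  have hz2 : ⟪dilation B z, z⟫ = 2 * (‖y‖ * ‖B y‖) := by
    rw [inner_dilation_apply]
    change ⟪B y, (‖y‖ / ‖B y‖) • B y⟫ + ⟪(‖y‖ / ‖B y‖) • B y, B y⟫ = _
    rw [real_inner_smul_left, real_inner_smul_right, real_inner_self_eq_norm_sq]
    field_simp
    ring
  have hz0 : z ≠ 0 := by
    rw [← norm_pos_iff]
    by_contra! hcon
    have : ‖z‖ = 0 := le_antisymm hcon (norm_nonneg _)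
    rw [this] at hz1
    nlinarith
  refine exp_rayleigh_le_tr_exp ((IsSelfAdjoint.all θ).smul (isSelfAdjoint_dilation B)) hz0 ?_
  rw [smul_apply, real_inner_smul_left, hz1, hz2]
  have : θ * (‖y‖ * (t * ‖y‖)) ≤ θ * (‖y‖ * ‖B y‖) := by gcongr
  nlinarith

/-- A matrix Bernstein inequality for the sums of `m` independent uniform samples from a finite
centered family of operators, in counting form. -/
theorem card_norm_sum_gt_mul_exp_le [Nontrivial E] {B : κ → E →L[ℝ] E} (hsum : ∑ a, B a = 0)
    {R V θ t : ℝ} (hθ : 0 ≤ θ) (ht : 0 ≤ t) (hR : ∀ a, ‖B a‖ ≤ R)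
    (hV : ∀ x, ∑ a, ‖B a x‖ ^ 2 ≤ Fintype.card κ * V * ‖x‖ ^ 2)
    (hV' : ∀ x, ∑ a, ‖star (B a) x‖ ^ 2 ≤ Fintype.card κ * V * ‖x‖ ^ 2) (m : ℕ) :
    {α : Fin m → κ | t < ‖∑ k, B (α k)‖}.ncard * Real.exp (θ * t) ≤
      (Fintype.card κ * Real.exp (θ ^ 2 * V * Real.exp (θ * R) / 2)) ^ m *
        (2 * Module.finrank ℝ E) := by
  classical
  have hfin : (Module.finrank ℝ (WithLp 2 (E × E)) : ℝ) = 2 * Module.finrank ℝ E := by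
    rw [(WithLp.linearEquiv 2 ℝ (E × E)).finrank_eq, Module.finrank_prod]
    push_cast; ring
  have key := sum_tr_exp_smul_sum_le (X := fun a => dilation (B a))
    (fun a => isSelfAdjoint_dilation _) (R := R) (V := V)
    (by rw [dilation_sum, hsum, dilation_zero]) hθ
    (fun a => (norm_dilation_le _).trans (hR a))
    (fun z => by
      simp only [norm_dilation_apply_sq]
      rw [Finset.sum_add_distrib, WithLp.prod_norm_sq_eq_of_L2]
      linarith [hV z.snd, hV' z.fst]) m
  rw [hfin] at key
  -- Markov's inequality by counting: each bad tuple contributes at least `exp (θ * t)`, and every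
  -- other term is nonnegative, being the trace of a square `N * N`.
  refine le_trans ?_ key
  rw [Set.ncard_eq_toFinset_card', ← nsmul_eq_mul, ← Finset.sum_const]
  refine (Finset.sum_le_sum (g := fun α : Fin m → κ => tr (exp (θ • ∑ k, dilation (B (α k)))))
    fun α hα => ?_).trans (Finset.sum_le_sum_of_subset_of_nonneg (Finset.subset_univ _) ?_)
  · rw [dilation_sum]
    exact exp_le_tr_exp_dilation hθ ht (by simpa using hα)
  · intro α _ _
    obtain ⟨N, hN, h⟩ := exists_exp_eq_mul_self
      (H := θ • ∑ k, dilation (B (α k))) ((IsSelfAdjoint.all θ).smul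
        (isSelfAdjoint_sum _ fun k _ => isSelfAdjoint_dilation _))
    rw [h]
    simpa [hN.star_eq] using tr_star_mul_self_nonneg N

end TraceInequality

end

noncomputable section

open Matrix

/-! ### Frobenius geometry of symmetric matrices. -/

namespace SymMat

variable {n : ℕ}

theorem inner_eq_trace (X Y : SymMat n) : inner ℝ X Y = trace (X.toMatrix * Y.toMatrix) := by
  rw [inner_def]
  simp only [trace, diag_apply, mul_apply]
  exact Finset.sum_congr rfl fun i _ => Finset.sum_congr rfl fun j _ => by rw [Y.isSymm.apply]

theorem norm_sq_eq_trace (X : SymMat n) : ‖X‖ ^ 2 = trace (X.toMatrix * X.toMatrix) := by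
  rw [← real_inner_self_eq_norm_sq, inner_eq_trace]

theorem norm_sq_eq_sum (X : SymMat n) : ‖X‖ ^ 2 = ∑ i, ∑ j, X.toMatrix i j ^ 2 := by
  rw [← real_inner_self_eq_norm_sq, inner_def]
  simp only [pow_two]

theorem finrank_le (n : ℕ) : Module.finrank ℝ (SymMat n) ≤ n ^ 2 := by
  calc Module.finrank ℝ (SymMat n) ≤ Module.finrank ℝ (Matrix (Fin n) (Fin n) ℝ) :=
        LinearMap.finrank_le_finrank_of_injective toMatrix_injective
    _ = n ^ 2 := by simp [Module.finrank_matrix, pow_two]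

end SymMat

/-! ### The dual bases and the centering map. -/

namespace EDG

variable {n : ℕ}

theorem sum_pair (f : Fin n → Fin n → ℝ) (hsymm : ∀ i j, f i j = f j i) (hdiag : ∀ i, f i i = 0) :
    ∑ p : Pair n, f p.1.1 p.1.2 = (∑ i, ∑ j, f i j) / 2 := by
  have h1 : ∑ p : Pair n, f p.1.1 p.1.2 = ∑ i, ∑ j, if i < j then f i j else 0 := by
    rw [← Fintype.sum_prod_type' (f := fun i j => if i < j then f i j else 0), ← Finset.sum_filter]
    exact (Finset.sum_subtype _ (fun x => by simp) fun x : Fin n × Fin n => f x.1 x.2).symm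
  have h2 : ∑ i, ∑ j, f i j = (∑ i, ∑ j, if i < j then f i j else 0) +
      ∑ i, ∑ j, if j < i then f j i else 0 := by
    rw [← Finset.sum_add_distrib]
    refine Finset.sum_congr rfl fun i _ => ?_
    rw [← Finset.sum_add_distrib]
    refine Finset.sum_congr rfl fun j _ => ?_
    rcases lt_trichotomy i j with h | h | h
    · simp [h, h.not_gt]
    · simp [h, hdiag]
    · simp [h, h.not_gt, hsymm i j]
  rw [h2, Finset.sum_comm (f := fun i j => if j < i then f j i else 0), h1]
  ring

theorem card_pair : (Fintype.card (Pair n) : ℝ) = numPairs n := by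
  have h := sum_pair (n := n) (fun i j => if i = j then 0 else 1)
    (fun i j => by simp [eq_comm]) (fun i => by simp)
  have h1 : ∑ p : Pair n, (if p.1.1 = p.1.2 then (0 : ℝ) else 1) = Fintype.card (Pair n) := by
    rw [Finset.sum_congr rfl fun p _ => if_neg p.2.ne]; simp
  have h2 : ∀ i : Fin n, ∑ j, (if i = j then (0 : ℝ) else 1) = n - 1 := fun i => by
    have : ∀ j, (if i = j then (0 : ℝ) else 1) = 1 - if i = j then 1 else 0 := fun j => by
      split_ifs <;> simp
    simp [this]
  rw [h1] at h
  rw [h, numPairs]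
  simp only [h2, Finset.sum_const, Finset.card_univ, Fintype.card_fin, nsmul_eq_mul]

/-- The centering matrix `I - 𝟏 𝟏ᵀ / n`. -/
def centeringMatrix (n : ℕ) : Matrix (Fin n) (Fin n) ℝ := Matrix.of a

theorem centeringMatrix_apply (i j : Fin n) :
    centeringMatrix n i j = (if i = j then 1 else 0) - 1 / (n : ℝ) := by
  simp [centeringMatrix, a, e, Pi.single_apply, eq_comm]

theorem centeringMatrix_transpose : (centeringMatrix n)ᵀ = centeringMatrix n := by
  ext i j
  simp [centeringMatrix_apply, eq_comm]

theorem centeringMatrix_comm (i j : Fin n) : centeringMatrix n i j = centeringMatrix n j i := by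
  simp [centeringMatrix_apply, eq_comm]

theorem sum_centeringMatrix (i : Fin n) : ∑ j, centeringMatrix n i j = 0 := by
  have : (n : ℝ) ≠ 0 := by
    have := i.pos
    positivity
  simp [centeringMatrix_apply, this]

theorem mul_centeringMatrix_apply (M : Matrix (Fin n) (Fin n) ℝ) (i j : Fin n) :
    (M * centeringMatrix n) i j = M i j - (∑ k, M i k) / n := by
  simp [mul_apply, centeringMatrix_apply, mul_sub, Finset.sum_sub_distrib, Finset.sum_mul,
    div_eq_mul_inv]

theorem centeringMatrix_mul_apply (M : Matrix (Fin n) (Fin n) ℝ) (i j : Fin n) :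
    (centeringMatrix n * M) i j = M i j - (∑ k, M k j) / n := by
  simp [mul_apply, centeringMatrix_apply, mul_sub, Finset.sum_sub_distrib, Finset.mul_sum,
    div_eq_mul_inv, mul_comm]

theorem mul_centeringMatrix {M : Matrix (Fin n) (Fin n) ℝ} (hM : ∀ i, ∑ j, M i j = 0) :
    M * centeringMatrix n = M := by
  ext i j
  rw [mul_centeringMatrix_apply, hM]; simp

theorem centeringMatrix_mul_self : centeringMatrix n * centeringMatrix n = centeringMatrix n :=
  mul_centeringMatrix sum_centeringMatrix

theorem inner_symOuter (X : SymMat n) (x y : Fin n → ℝ) :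
    inner ℝ X (symOuter x y) = 2 * (x ⬝ᵥ X.toMatrix *ᵥ y) := by
  rw [SymMat.inner_eq_trace, symOuter, SymMat.toMatrix_mk, Matrix.mul_add, trace_add,
    mul_vecMulVec, mul_vecMulVec, trace_vecMulVec, trace_vecMulVec, dotProduct_comm _ x,
    ← vecMul_transpose, X.isSymm.eq, ← dotProduct_mulVec]
  ring

theorem e_dotProduct_mulVec_e (M : Matrix (Fin n) (Fin n) ℝ) (i j : Fin n) :
    e i ⬝ᵥ M *ᵥ e j = M i j := by
  simp [e]

theorem inner_w (X : SymMat n) (p : Pair n) : inner ℝ X (w p) =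
    X.toMatrix p.1.1 p.1.1 + X.toMatrix p.1.2 p.1.2 - 2 * X.toMatrix p.1.1 p.1.2 := by
  rw [w, inner_sub_right, inner_add_right, inner_smul_right, inner_smul_right, inner_symOuter,
    inner_symOuter, inner_symOuter]
  simp only [e_dotProduct_mulVec_e]
  ring

theorem a_eq (i : Fin n) : a i = centeringMatrix n *ᵥ e i := by
  ext k
  simp [e, centeringMatrix_apply, a, Pi.single_apply, mulVec_single]

theorem a_dotProduct_mulVec_a (M : Matrix (Fin n) (Fin n) ℝ) (i j : Fin n) :
    a i ⬝ᵥ M *ᵥ a j = (centeringMatrix n * M * centeringMatrix n) i j := by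
  rw [← e_dotProduct_mulVec_e (centeringMatrix n * M * centeringMatrix n), a_eq, a_eq, ← mulVec_mulVec, ← mulVec_mulVec,
    dotProduct_mulVec (e i), ← mulVec_transpose, centeringMatrix_transpose]

theorem inner_v (X : SymMat n) (p : Pair n) : inner ℝ X (v p) =
    -(centeringMatrix n * X.toMatrix * centeringMatrix n) p.1.1 p.1.2 := by
  rw [v, inner_neg_right, inner_smul_right, inner_symOuter, a_dotProduct_mulVec_a]
  ring

theorem inner_wDiag (X : SymMat n) (i : Fin n) :
    inner ℝ X (wDiag i) = ∑ j, X.toMatrix i j := by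
  rw [wDiag, inner_smul_right, inner_symOuter]
  simp [e, mulVec, dotProduct, Pi.single_apply]

theorem toMatrix_symOuter (x y : Fin n → ℝ) :
    (symOuter x y).toMatrix = vecMulVec x y + vecMulVec y x := rfl

theorem toMatrix_w (p : Pair n) :
    (w p).toMatrix = vecMulVec (e p.1.1 - e p.1.2) (e p.1.1 - e p.1.2) := by
  ext i j
  simp only [w, map_sub, map_add, map_smul, toMatrix_symOuter, vecMulVec_apply, Pi.sub_apply,
    smul_eq_mul, Matrix.sub_apply, Matrix.add_apply, Matrix.smul_apply]
  ring

/-- The centering map `X ↦ J X J` of symmetric matrices. -/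
def centering : SymMat n →L[ℝ] SymMat n := ∑ p : Pair n, (innerSL ℝ (w p)).smulRight (v p)

/-- Columns of `J` sum to zero, so the contributions of `X i i` and `X j j` vanish and only `-2 * X
i j` survives. -/
theorem toMatrix_centering (X : SymMat n) : (centering X).toMatrix =
    centeringMatrix n * X.toMatrix * centeringMatrix n := by
  set J := centeringMatrix n with hJ
  ext k l
  have h1 : (centering X).toMatrix k l = ∑ p : Pair n,
      (X.toMatrix p.1.1 p.1.1 + X.toMatrix p.1.2 p.1.2 - 2 * X.toMatrix p.1.1 p.1.2) *
        (-(1 / 2) * (J p.1.1 k * J p.1.2 l + J p.1.2 k * J p.1.1 l)) := by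
    simp only [centering, _root_.sum_apply, ContinuousLinearMap.smulRight_apply, map_sum, map_smul,
      innerSL_apply_apply, real_inner_comm X, inner_w, Matrix.sum_apply, Matrix.smul_apply]
    refine Finset.sum_congr rfl fun p _ => ?_
    rw [v]
    simp only [map_neg, map_smul, toMatrix_symOuter, Matrix.neg_apply, Matrix.smul_apply,
      Matrix.add_apply, vecMulVec_apply, smul_eq_mul, hJ, centeringMatrix, Matrix.of_apply]
    ring
  rw [h1, sum_pair (fun i j => (X.toMatrix i i + X.toMatrix j j - 2 * X.toMatrix i j) *
        (-(1 / 2) * (J i k * J j l + J j k * J i l)))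
      (fun i j => by rw [X.isSymm.apply i j]; ring) (fun i => by ring)]
  have hsum : ∀ l, ∑ j, J j l = 0 := fun l => by
    rw [← sum_centeringMatrix l]
    exact Finset.sum_congr rfl fun j _ => centeringMatrix_comm _ _
  have hA : ∀ (d : Fin n → ℝ) (k l : Fin n), ∑ i, ∑ j, d i * (J i k * J j l) = 0 := fun d k l => by
    simp only [← mul_assoc, ← Finset.mul_sum, hsum, mul_zero, Finset.sum_const_zero]
  have hB : ∀ (d : Fin n → ℝ) (k l : Fin n), ∑ i, ∑ j, d j * (J i k * J j l) = 0 := fun d k l => by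
    rw [Finset.sum_comm, ← hA d l k]
    exact Finset.sum_congr rfl fun i _ => Finset.sum_congr rfl fun j _ => by ring
  have hC : ∀ k l, ∑ i, ∑ j, X.toMatrix i j * (J i k * J j l) = (J * X.toMatrix * J) k l :=
    fun k l => by
    simp only [mul_apply, Finset.sum_mul]
    rw [Finset.sum_comm]
    refine Finset.sum_congr rfl fun i _ => Finset.sum_congr rfl fun j _ => ?_
    rw [hJ, centeringMatrix_comm k j]
    ring
  have hC' : (J * X.toMatrix * J) l k = (J * X.toMatrix * J) k l := by
    rw [← transpose_apply (J * X.toMatrix * J), transpose_mul, transpose_mul, X.isSymm.eq, hJ,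
      centeringMatrix_transpose, Matrix.mul_assoc]
  have hsplit : ∑ i, ∑ j, (X.toMatrix i i + X.toMatrix j j - 2 * X.toMatrix i j) *
      (-(1 / 2) * (J i k * J j l + J j k * J i l)) =
      -(1 / 2) * (∑ i, ∑ j, X.toMatrix i i * (J i k * J j l) +
        ∑ i, ∑ j, X.toMatrix i i * (J i l * J j k) + ∑ i, ∑ j, X.toMatrix j j * (J i k * J j l) +
        ∑ i, ∑ j, X.toMatrix j j * (J i l * J j k)) +
      (∑ i, ∑ j, X.toMatrix i j * (J i k * J j l) + ∑ i, ∑ j, X.toMatrix i j * (J i l * J j k)) := by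
    simp only [← Finset.sum_add_distrib, Finset.mul_sum]
    exact Finset.sum_congr rfl fun i _ => Finset.sum_congr rfl fun j _ => by ring
  rw [hsplit, hA fun i => X.toMatrix i i, hA fun i => X.toMatrix i i, hB fun i => X.toMatrix i i,
    hB fun i => X.toMatrix i i, hC, hC, hC']
  ring

/-- `(w_α)`, `(w_{ii})` and `(v_α)`, `(v_{ii})` are dual bases. -/
theorem centering_add_sum_wDiag_vDiag :
    centering + ∑ i : Fin n, (innerSL ℝ (wDiag i)).smulRight (vDiag i) =
      ContinuousLinearMap.id ℝ (SymMat n) := by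
  ext1 X
  apply SymMat.toMatrix_injective
  ext k l
  have hn : (n : ℝ) ≠ 0 := by
    have := k.pos
    positivity
  simp only [_root_.add_apply, map_add, toMatrix_centering, Matrix.add_apply, _root_.sum_apply,
    ContinuousLinearMap.smulRight_apply, map_sum, map_smul, innerSL_apply_apply,
    real_inner_comm X, inner_wDiag, Matrix.sum_apply, Matrix.smul_apply,
    ContinuousLinearMap.id_apply]
  -- Weighting these entries with the row sums of `X` gives exactly `X - J X J`.
  have hv : ∀ i, (vDiag i).toMatrix k l = (if i = k then 1 else 0) / (n : ℝ) +
      (if i = l then 1 else 0) / (n : ℝ) - 1 / (n : ℝ) ^ 2 := fun i => by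
    simp only [vDiag, map_sub, map_smul, toMatrix_symOuter, Matrix.sub_apply, Matrix.smul_apply,
      Matrix.add_apply, vecMulVec_apply, smul_eq_mul, a, e, Pi.single_apply, eq_comm (a := k),
      eq_comm (a := l)]
    field_simp
    ring
  simp only [hv, smul_eq_mul]
  rw [mul_centeringMatrix_apply]
  have hJX : ∀ j, (centeringMatrix n * X.toMatrix) k j =
      X.toMatrix k j - (∑ i, X.toMatrix j i) / n := fun j => by
    rw [centeringMatrix_mul_apply]
    simp only [X.isSymm.apply j]
  simp only [hJX, mul_add, mul_sub, Finset.sum_add_distrib, Finset.sum_sub_distrib, mul_div_assoc',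
    mul_ite, mul_one, mul_zero, ← Finset.sum_div, Finset.sum_ite_eq', Finset.mem_univ, if_true]
  field_simp
  ring

/-- `X ↦ J X J` is an orthogonal projection: `‖J X J‖² = ⟨X, J X J⟩`. -/
theorem norm_centering_le (X : SymMat n) : ‖centering X‖ ≤ ‖X‖ := by
  have h : ‖centering X‖ ^ 2 = inner ℝ X (centering X) := by
    rw [SymMat.norm_sq_eq_trace, SymMat.inner_eq_trace, toMatrix_centering, ← Matrix.mul_assoc,
      trace_mul_comm]
    simp only [← Matrix.mul_assoc, centeringMatrix_mul_self]
    rw [Matrix.mul_assoc (centeringMatrix n * X.toMatrix), centeringMatrix_mul_self,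
      Matrix.mul_assoc (centeringMatrix n * X.toMatrix), trace_mul_comm, Matrix.mul_assoc,
      trace_mul_comm]
    simp only [Matrix.mul_assoc]
  have h2 := real_inner_le_norm X (centering X)
  rw [← h] at h2
  by_contra! hlt
  nlinarith [norm_nonneg X]

/-- `Q` is the orthogonal projection onto the range of the symmetric matrix `X`. -/
structure IsRangeProj (X Q : Matrix (Fin n) (Fin n) ℝ) : Prop where
  transpose_eq : Qᵀ = Q
  mul_self : Q * Q = Q
  mul_eq : Q * X = X
  exists_eq : ∃ C, Q = C * X
  trace_eq : trace Q = X.rank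

/-- In an eigenbasis of `X`, `Q` is the indicator of the nonzero eigenvalues. The witness for `Q = C
* X` is the pseudoinverse, with `0⁻¹ = 0` on the kernel. -/
theorem exists_isRangeProj {X : Matrix (Fin n) (Fin n) ℝ} (hX : X.IsSymm) :
    ∃ Q, IsRangeProj X Q := by
  have hH : X.IsHermitian := by rwa [Matrix.IsHermitian, conjTranspose_eq_transpose_of_trivial]
  set U : Matrix (Fin n) (Fin n) ℝ := hH.eigenvectorUnitary.1 with hU
  set d := hH.eigenvalues with hd
  have hUU : Uᵀ * U = 1 := by
    rw [← conjTranspose_eq_transpose_of_trivial]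
    exact Unitary.coe_star_mul_self hH.eigenvectorUnitary
  have hspec : X = U * diagonal d * Uᵀ := by
    have h := hH.spectral_theorem
    rw [Unitary.conjStarAlgAut_apply] at h
    rw [← conjTranspose_eq_transpose_of_trivial]
    exact h
  have hmul : ∀ f g : Fin n → ℝ, U * diagonal f * Uᵀ * (U * diagonal g * Uᵀ) =
      U * diagonal (fun i => f i * g i) * Uᵀ := fun f g => by
    rw [← diagonal_mul_diagonal]
    calc _ = U * diagonal f * (Uᵀ * U) * diagonal g * Uᵀ := by simp only [Matrix.mul_assoc]
      _ = _ := by rw [hUU, Matrix.mul_one]; simp only [Matrix.mul_assoc]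
  refine ⟨U * diagonal (fun i => if d i = 0 then 0 else 1) * Uᵀ, ?_, ?_, ?_, ?_, ?_⟩
  · simp [Matrix.mul_assoc]
  · rw [hmul]
    congr 3
    ext i
    by_cases h : d i = 0 <;> simp [h]
  · conv_lhs => rw [hspec, hmul]
    conv_rhs => rw [hspec]
    congr 3
    ext i
    by_cases h : d i = 0 <;> simp [h]
  · refine ⟨U * diagonal (fun i => (d i)⁻¹) * Uᵀ, ?_⟩
    conv_rhs => rw [hspec, hmul]
    congr 3
    ext i
    by_cases h : d i = 0 <;> simp [h]
  · rw [trace_mul_comm, ← Matrix.mul_assoc, hUU, Matrix.one_mul, trace_diagonal,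
      hH.rank_eq_card_non_zero_eigs, Fintype.card_subtype]
    simp [hd, Finset.sum_ite]

/-! ### The tangent projection through the range projection `Q`. -/

namespace IsRangeProj

variable {X : SymMat n} {Q : Matrix (Fin n) (Fin n) ℝ}

theorem eq_mul (hQ : IsRangeProj X.toMatrix Q) : X.toMatrix * Q = X.toMatrix := by
  have := congrArg transpose hQ.mul_eq
  rwa [transpose_mul, X.isSymm.eq, hQ.transpose_eq] at this

theorem apply_comm (hQ : IsRangeProj X.toMatrix Q) (i j : Fin n) : Q i j = Q j i :=
  congrFun (congrFun hQ.transpose_eq j) i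

theorem mem_tangentSpace_iff (hQ : IsRangeProj X.toMatrix Q) (Y : SymMat n) :
    Y ∈ tangentSpace X ↔
      Y.toMatrix = Q * Y.toMatrix + Y.toMatrix * Q - Q * Y.toMatrix * Q := by
  constructor
  · rintro ⟨Z, rfl⟩
    change Z * X.toMatrix + X.toMatrix * Zᵀ = Q * (Z * X.toMatrix + X.toMatrix * Zᵀ) +
      (Z * X.toMatrix + X.toMatrix * Zᵀ) * Q - Q * (Z * X.toMatrix + X.toMatrix * Zᵀ) * Q
    have h1 : Z * X.toMatrix * Q = Z * X.toMatrix := by rw [Matrix.mul_assoc, hQ.eq_mul]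
    have h2 : Q * (X.toMatrix * Zᵀ) = X.toMatrix * Zᵀ := by rw [← Matrix.mul_assoc, hQ.mul_eq]
    have h3 : Q * (Z * X.toMatrix) * Q = Q * (Z * X.toMatrix) := by rw [Matrix.mul_assoc, h1]
    rw [Matrix.mul_add, h2, Matrix.add_mul, h1, Matrix.add_mul, h3]
    abel
  · intro h
    obtain ⟨C, hC⟩ := hQ.exists_eq
    have hC' : Q = X.toMatrix * Cᵀ := by
      rw [← hQ.transpose_eq, hC, transpose_mul, X.isSymm.eq]
    -- Here `Z * X = (Y - Q Y / 2) * Q`. Adding the transpose counts `Q Y Q` once negatively, which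
    -- reproduces `Q Y + Y Q - Q Y Q`.
    refine ⟨(Y.toMatrix - (1 / 2 : ℝ) • (Q * Y.toMatrix)) * C, ?_⟩
    apply SymMat.toMatrix_injective
    change (Y.toMatrix - (1 / 2 : ℝ) • (Q * Y.toMatrix)) * C * X.toMatrix +
      X.toMatrix * ((Y.toMatrix - (1 / 2 : ℝ) • (Q * Y.toMatrix)) * C)ᵀ = Y.toMatrix
    rw [transpose_mul, Matrix.mul_assoc, ← hC, ← Matrix.mul_assoc, ← hC', transpose_sub,
      transpose_smul, transpose_mul, Y.isSymm.eq, hQ.transpose_eq]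
    conv_rhs => rw [h]
    rw [Matrix.sub_mul, Matrix.mul_sub, Matrix.smul_mul, Matrix.mul_smul, ← Matrix.mul_assoc]
    module

/-- The residual is `(1 - Q) Y (1 - Q)`, and tangent vectors `W` satisfy `(1 - Q) W (1 - Q) = 0`. -/
theorem toMatrix_tangentProj (hQ : IsRangeProj X.toMatrix Q) (Y : SymMat n) :
    (tangentProj X Y).toMatrix = Q * Y.toMatrix + Y.toMatrix * Q - Q * Y.toMatrix * Q := by
  set P : SymMat n := SymMat.mk (Q * Y.toMatrix + Y.toMatrix * Q - Q * Y.toMatrix * Q) (by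
    rw [Matrix.IsSymm]
    simp only [transpose_add, transpose_sub, transpose_mul, Y.isSymm.eq, hQ.transpose_eq,
      Matrix.mul_assoc]
    abel) with hP
  have hPm : P.toMatrix = Q * Y.toMatrix + Y.toMatrix * Q - Q * Y.toMatrix * Q := rfl
  have hQQ : ∀ M, Q * (Q * M) = Q * M := fun M => by rw [← Matrix.mul_assoc, hQ.mul_self]
  suffices tangentProj X Y = P by rw [this, hPm]
  refine Submodule.eq_starProjection_of_mem_of_inner_eq_zero ?_ fun W hW => ?_
  · rw [hQ.mem_tangentSpace_iff, hPm]
    simp only [Matrix.mul_add, Matrix.mul_sub, Matrix.add_mul, Matrix.sub_mul, Matrix.mul_assoc,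
      hQ.mul_self, hQQ]
    abel
  · rw [hQ.mem_tangentSpace_iff] at hW
    have key : (1 - Q) * W.toMatrix * (1 - Q) = 0 := by
      have : (1 - Q) * W.toMatrix * (1 - Q) =
          W.toMatrix - (Q * W.toMatrix + W.toMatrix * Q - Q * W.toMatrix * Q) := by noncomm_ring
      rw [this, ← hW, sub_self]
    have h2 : (Y - P).toMatrix = (1 - Q) * (Y.toMatrix * (1 - Q)) := by
      rw [map_sub, hPm]; noncomm_ring
    rw [SymMat.inner_eq_trace, h2, Matrix.mul_assoc, trace_mul_comm, Matrix.mul_assoc,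
      Matrix.mul_assoc, ← Matrix.mul_assoc (1 - Q), key, Matrix.mul_zero, trace_zero]

theorem sum_sq (hQ : IsRangeProj X.toMatrix Q) (i : Fin n) : ∑ j, Q i j ^ 2 = Q i i := by
  conv_rhs => rw [← hQ.mul_self, mul_apply]
  exact Finset.sum_congr rfl fun j _ => by rw [hQ.apply_comm j i, pow_two]

theorem diag_nonneg (hQ : IsRangeProj X.toMatrix Q) (i : Fin n) : 0 ≤ Q i i := by
  rw [← hQ.sum_sq i]; positivity

theorem sq_add_sq_le (hQ : IsRangeProj X.toMatrix Q) {i j : Fin n} (h : i ≠ j) :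
    Q i i ^ 2 + Q i j ^ 2 ≤ Q i i := by
  classical
  conv_rhs => rw [← hQ.sum_sq i]
  rw [← Finset.sum_pair (f := fun k => Q i k ^ 2) h]
  exact Finset.sum_le_sum_of_subset_of_nonneg (Finset.subset_univ _) fun _ _ _ => sq_nonneg _

theorem two_mul_abs_le (hQ : IsRangeProj X.toMatrix Q) (i j : Fin n) :
    2 * |Q i j| ≤ Q i i + Q j j := by
  have hx : ∀ c : ℝ, 0 ≤ ∑ k, (Q i k + c * Q j k) ^ 2 := fun c => by positivity
  have hexp : ∀ c : ℝ, ∑ k, (Q i k + c * Q j k) ^ 2 = Q i i + 2 * c * Q i j + c ^ 2 * Q j j :=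
    fun c => by
    have hij : Q i j = ∑ k, Q i k * Q j k := by
      conv_lhs => rw [← hQ.mul_self, mul_apply]
      exact Finset.sum_congr rfl fun k _ => by rw [hQ.apply_comm k j]
    rw [← hQ.sum_sq i, ← hQ.sum_sq j, hij, Finset.mul_sum, Finset.mul_sum,
      ← Finset.sum_add_distrib, ← Finset.sum_add_distrib]
    exact Finset.sum_congr rfl fun k _ => by ring
  have h1 := hx 1
  have h2 := hx (-1)
  rw [hexp] at h1 h2
  have : |Q i j| ≤ (Q i i + Q j j) / 2 := abs_le.2 ⟨by linarith, by linarith⟩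
  linarith

theorem sum_row (hQ : IsRangeProj X.toMatrix Q) (hX : X.toMatrix *ᵥ 1 = 0) (i : Fin n) :
    ∑ j, Q i j = 0 := by
  obtain ⟨C, hC⟩ := hQ.exists_eq
  have : Q *ᵥ 1 = 0 := by rw [hC, ← mulVec_mulVec, hX, mulVec_zero]
  simpa [mulVec, dotProduct] using congrFun this i

theorem mul_centeringMatrix (hQ : IsRangeProj X.toMatrix Q) (hX : X.toMatrix *ᵥ 1 = 0) :
    Q * centeringMatrix n = Q := EDG.mul_centeringMatrix (hQ.sum_row hX)

theorem centeringMatrix_mul (hQ : IsRangeProj X.toMatrix Q) (hX : X.toMatrix *ᵥ 1 = 0) :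
    centeringMatrix n * Q = Q := by
  have := congrArg transpose (hQ.mul_centeringMatrix hX)
  rwa [transpose_mul, hQ.transpose_eq, centeringMatrix_transpose] at this

/-- The tangent space is invariant under centering. -/
theorem tangentProj_centering_tangentProj (hQ : IsRangeProj X.toMatrix Q)
    (hX : X.toMatrix *ᵥ 1 = 0) (Y : SymMat n) :
    tangentProj X (centering (tangentProj X Y)) = centering (tangentProj X Y) := by
  apply SymMat.toMatrix_injective
  have hQJ := hQ.mul_centeringMatrix hX
  have hJQ := hQ.centeringMatrix_mul hX
  have hQQ : ∀ M, Q * (Q * M) = Q * M := fun M => by rw [← Matrix.mul_assoc, hQ.mul_self]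
  have hQJ' : ∀ M, Q * (centeringMatrix n * M) = Q * M := fun M => by rw [← Matrix.mul_assoc, hQJ]
  have hJQ' : ∀ M, centeringMatrix n * (Q * M) = Q * M := fun M => by rw [← Matrix.mul_assoc, hJQ]
  rw [hQ.toMatrix_tangentProj, toMatrix_centering, hQ.toMatrix_tangentProj]
  simp only [Matrix.mul_add, Matrix.mul_sub, Matrix.add_mul, Matrix.sub_mul, Matrix.mul_assoc,
      hQ.mul_self, hQQ, hQJ, hJQ, hQJ', hJQ']
  abel

/-- Diagonal entries of tangent vectors are controlled by the leverage scores `Q i i`. -/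
theorem sum_diag_sq_le (hQ : IsRangeProj X.toMatrix Q) {s : ℝ} (hs : ∀ i, Q i i ≤ s) (hs0 : 0 ≤ s)
    {Y : SymMat n} (hY : tangentProj X Y = Y) :
    ∑ i, Y.toMatrix i i ^ 2 ≤ 2 * s * ‖Y‖ ^ 2 := by
  have hQQ : ∀ M, Q * (Q * M) = Q * M := fun M => by rw [← Matrix.mul_assoc, hQ.mul_self]
  -- This splits `Y = M + Mᵀ` with `Q M = M`. Since `tr (M M) = ‖Q Y Q‖² / 4 ≥ 0`, it follows that
  -- `2 ∑ M i j ^ 2 ≤ ‖Y‖²`; and `Y i i = 2 (Q M) i i` is bounded by Cauchy–Schwarz.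
  set M := Q * Y.toMatrix - (1 / 2 : ℝ) • (Q * Y.toMatrix * Q) with hM
  have hQM : Q * M = M := by
    rw [hM, Matrix.mul_sub, Matrix.mul_smul, Matrix.mul_assoc, hQQ, hQQ]
  have hYM : Y.toMatrix = M + Mᵀ := by
    conv_lhs => rw [← hY, hQ.toMatrix_tangentProj]
    rw [hM, transpose_sub, transpose_smul, transpose_mul, transpose_mul, transpose_mul,
      Y.isSymm.eq, hQ.transpose_eq, ← Matrix.mul_assoc]
    module
  have hMM : 0 ≤ trace (M * M) := by
    set S : SymMat n := SymMat.mk (Q * Y.toMatrix * Q) (by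
      rw [Matrix.IsSymm, transpose_mul, transpose_mul, Y.isSymm.eq, hQ.transpose_eq,
        Matrix.mul_assoc]) with hS
    have hSS : ‖S‖ ^ 2 = trace (Q * (Y.toMatrix * (Q * Y.toMatrix))) := by
      rw [SymMat.norm_sq_eq_trace]
      change trace (Q * Y.toMatrix * Q * (Q * Y.toMatrix * Q)) = _
      rw [trace_mul_comm, Matrix.mul_assoc, trace_mul_comm]
      simp only [Matrix.mul_assoc, hQQ]
    have h1 : trace (Q * (Y.toMatrix * (Q * (Y.toMatrix * Q)))) =
        trace (Q * (Y.toMatrix * (Q * Y.toMatrix))) := by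
      rw [← Matrix.mul_assoc, ← Matrix.mul_assoc, ← Matrix.mul_assoc, trace_mul_comm]
      simp only [Matrix.mul_assoc, hQQ]
    have h2 : trace (M * M) = (1 / 4) * trace (Q * (Y.toMatrix * (Q * Y.toMatrix))) := by
      rw [hM]
      simp only [Matrix.mul_sub, Matrix.sub_mul, Matrix.mul_smul, Matrix.smul_mul, trace_sub,
        trace_smul, Matrix.mul_assoc, hQQ, h1, smul_eq_mul]
      ring
    rw [h2, ← hSS]
    positivity
  have hnorm : ‖Y‖ ^ 2 = 2 * ∑ i, ∑ j, M i j ^ 2 + 2 * trace (M * M) := by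
    have hT : trace (Mᵀ * Mᵀ) = trace (M * M) := by rw [← transpose_mul, trace_transpose]
    have hT2 : trace (Mᵀ * M) = trace (M * Mᵀ) := trace_mul_comm _ _
    have hT3 : trace (M * Mᵀ) = ∑ i, ∑ j, M i j ^ 2 := by
      simp [trace, mul_apply, pow_two]
    rw [SymMat.norm_sq_eq_trace, hYM, Matrix.mul_add, Matrix.add_mul, Matrix.add_mul, trace_add,
      trace_add, trace_add, hT, hT2, hT3]
    ring
  have hdiag : ∀ i, Y.toMatrix i i ^ 2 ≤ 4 * s * ∑ k, M k i ^ 2 := fun i => by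
    have h1 : Y.toMatrix i i = 2 * ∑ k, Q i k * M k i := by
      rw [hYM, Matrix.add_apply, transpose_apply, ← mul_apply, hQM]; ring
    have h2 := Finset.sum_mul_sq_le_sq_mul_sq Finset.univ (fun k => Q i k) (fun k => M k i)
    rw [hQ.sum_sq] at h2
    have h3 : Q i i * ∑ k, M k i ^ 2 ≤ s * ∑ k, M k i ^ 2 := by gcongr; exact hs i
    rw [h1, mul_pow]
    linarith
  calc ∑ i, Y.toMatrix i i ^ 2 ≤ ∑ i, 4 * s * ∑ k, M k i ^ 2 := Finset.sum_le_sum fun i _ => hdiag i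
    _ = 4 * s * ∑ i, ∑ j, M i j ^ 2 := by rw [← Finset.mul_sum, Finset.sum_comm]
    _ = 2 * s * (2 * ∑ i, ∑ j, M i j ^ 2) := by ring
    _ ≤ _ := by gcongr; linarith

end IsRangeProj

/-! ### Energies against `w` and `v`. -/

/-- Zero row sums kill the cross terms between diagonal and off-diagonal entries. All three
remaining terms are nonnegative, so a bound on the sum bounds each. -/
theorem sum_inner_w_sq (Y : SymMat n) (hY : ∀ i, ∑ j, Y.toMatrix i j = 0) :
    ∑ p : Pair n, inner ℝ Y (w p) ^ 2 =
      n * ∑ i, Y.toMatrix i i ^ 2 + (∑ i, Y.toMatrix i i) ^ 2 + 2 * ‖Y‖ ^ 2 := by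
  simp only [inner_w]
  rw [sum_pair (fun i j => (Y.toMatrix i i + Y.toMatrix j j - 2 * Y.toMatrix i j) ^ 2)
    (fun i j => by rw [Y.isSymm.apply i j]; ring) (fun i => by ring)]
  set d := fun i => Y.toMatrix i i
  have h1 : ∑ i, ∑ j, (Y.toMatrix i i + Y.toMatrix j j - 2 * Y.toMatrix i j) ^ 2 =
      ∑ i, ∑ _j : Fin n, d i ^ 2 + ∑ _i : Fin n, ∑ j, d j ^ 2 + 2 * (∑ i, ∑ j, d i * d j) +
      4 * ∑ i, ∑ j, Y.toMatrix i j ^ 2 - 4 * (∑ i, ∑ j, d i * Y.toMatrix i j) -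
      4 * ∑ i, ∑ j, d j * Y.toMatrix i j := by
    simp only [Finset.mul_sum, ← Finset.sum_add_distrib, ← Finset.sum_sub_distrib]
    exact Finset.sum_congr rfl fun i _ => Finset.sum_congr rfl fun j _ => by ring
  have h2 : ∑ i, ∑ j, d i * Y.toMatrix i j = 0 := by simp [← Finset.mul_sum, hY]
  have h3 : ∑ i, ∑ j, d j * Y.toMatrix i j = 0 := by
    rw [Finset.sum_comm, ← h2]
    exact Finset.sum_congr rfl fun i _ => Finset.sum_congr rfl fun j _ => by rw [Y.isSymm.apply]
  have h4 : ∑ i, ∑ j, d i * d j = (∑ i, d i) ^ 2 := by rw [pow_two, Finset.sum_mul_sum]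
  rw [h1, h2, h3, h4, SymMat.norm_sq_eq_sum]
  simp [← Finset.mul_sum]
  ring

theorem sum_inner_w_sq_le (Y : SymMat n) (hY : ∀ i, ∑ j, Y.toMatrix i j = 0) :
    ∑ p : Pair n, inner ℝ Y (w p) ^ 2 ≤ 2 * n * ∑ i, Y.toMatrix i i ^ 2 + 2 * ‖Y‖ ^ 2 := by
  have h := sq_sum_le_card_mul_sum_sq (s := (Finset.univ : Finset (Fin n)))
    (f := fun i => Y.toMatrix i i)
  rw [Finset.card_univ, Fintype.card_fin] at h
  rw [sum_inner_w_sq Y hY]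
  linarith

/-- `w p` is the square of `e_i - e_j`, which is orthogonal to `𝟏` and hence fixed by `J`. -/
theorem inner_centering_w (Y : SymMat n) (p : Pair n) :
    inner ℝ (centering Y) (w p) = inner ℝ Y (w p) := by
  rw [SymMat.inner_eq_trace, SymMat.inner_eq_trace, toMatrix_centering, toMatrix_w]
  set z := e p.1.1 - e p.1.2 with hz
  have hJz : centeringMatrix n *ᵥ z = z := by
    ext k
    rw [hz, mulVec_sub, ← a_eq, ← a_eq]
    simp [a]
  have hzJ : z ᵥ* centeringMatrix n = z := by
    rw [← mulVec_transpose, centeringMatrix_transpose, hJz]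
  rw [Matrix.mul_assoc, Matrix.mul_assoc, mul_vecMulVec, hJz, trace_mul_comm, Matrix.mul_assoc,
    vecMulVec_mul, hzJ]

theorem sum_row_centering (Y : SymMat n) (i : Fin n) : ∑ j, (centering Y).toMatrix i j = 0 := by
  rw [toMatrix_centering]
  simp only [mul_apply (N := centeringMatrix n)]
  rw [Finset.sum_comm]
  simp [← Finset.mul_sum, sum_centeringMatrix]

theorem sum_inner_v_sq_le (Y : SymMat n) :
    ∑ p : Pair n, inner ℝ Y (v p) ^ 2 ≤ ‖Y‖ ^ 2 / 2 := by
  have hc : ∀ p : Pair n, inner ℝ Y (v p) ^ 2 = (centering Y).toMatrix p.1.1 p.1.2 ^ 2 := fun p => by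
    rw [inner_v, ← toMatrix_centering, neg_sq]
  have h1 := sum_pair (n := n) (fun i j => if i = j then 0 else (centering Y).toMatrix i j ^ 2)
    (fun i j => by rw [(centering Y).isSymm.apply i j]; simp [eq_comm]) (fun i => by simp)
  have h2 : ∑ p : Pair n, inner ℝ Y (v p) ^ 2 = ∑ p : Pair n,
      if p.1.1 = p.1.2 then 0 else (centering Y).toMatrix p.1.1 p.1.2 ^ 2 :=
    Finset.sum_congr rfl fun p _ => by rw [hc, if_neg p.2.ne]
  rw [h2, h1]
  have h3 : ∑ i, ∑ j, (if i = j then 0 else (centering Y).toMatrix i j ^ 2) ≤ ‖Y‖ ^ 2 := by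
    calc _ ≤ ∑ i, ∑ j, (centering Y).toMatrix i j ^ 2 :=
          Finset.sum_le_sum fun i _ => Finset.sum_le_sum fun j _ => by
            split_ifs
            · positivity
            · exact le_rfl
      _ = ‖centering Y‖ ^ 2 := (SymMat.norm_sq_eq_sum _).symm
      _ ≤ _ := by gcongr; exact norm_centering_le Y
  linarith

theorem sum_row_mul {M N : Matrix (Fin n) (Fin n) ℝ} (hN : ∀ i, ∑ j, N i j = 0) (i : Fin n) :
    ∑ j, (M * N) i j = 0 := by
  simp only [mul_apply]
  rw [Finset.sum_comm]
  simp [← Finset.mul_sum, hN]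

theorem norm_tangentProj_sq (X Y : SymMat n) :
    ‖tangentProj X Y‖ ^ 2 = inner ℝ (tangentProj X Y) Y := by
  rw [← real_inner_self_eq_norm_sq, tangentProj, Submodule.inner_starProjection_left_eq_right,
    Submodule.starProjection_eq_self_iff.2 (Submodule.starProjection_apply_mem _ _),
    ← Submodule.inner_starProjection_left_eq_right]

theorem inner_tangentProj_left (X Y Z : SymMat n) :
    inner ℝ (tangentProj X Y) Z = inner ℝ Y (tangentProj X Z) :=
  Submodule.inner_starProjection_left_eq_right _ _ _

theorem tangentProj_tangentProj (X Y : SymMat n) :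
    tangentProj X (tangentProj X Y) = tangentProj X Y :=
  Submodule.starProjection_eq_self_iff.2 (Submodule.starProjection_apply_mem _ _)

theorem norm_tangentProj_le (X Y : SymMat n) : ‖tangentProj X Y‖ ≤ ‖Y‖ :=
  Submodule.norm_starProjection_apply_le _ _

theorem a_dotProduct_a (i j : Fin n) : a i ⬝ᵥ a j = (if i = j then 1 else 0) - 1 / (n : ℝ) := by
  have h := a_dotProduct_mulVec_a (1 : Matrix (Fin n) (Fin n) ℝ) i j
  rwa [one_mulVec, Matrix.mul_one, centeringMatrix_mul_self, centeringMatrix_apply] at h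

/-! ### Consequences of incoherence and leverage bounds. -/

namespace IsRangeProj

variable {X : SymMat n} {Q : Matrix (Fin n) (Fin n) ℝ}

theorem sum_row_tangentProj_w (hQ : IsRangeProj X.toMatrix Q) (hX : X.toMatrix *ᵥ 1 = 0)
    (p : Pair n) (i : Fin n) : ∑ j, (tangentProj X (w p)).toMatrix i j = 0 := by
  have hw : ∀ i, ∑ j, (w p).toMatrix i j = 0 := fun i => by
    simp only [toMatrix_w, vecMulVec_apply, ← Finset.mul_sum]
    simp [e]
  rw [hQ.toMatrix_tangentProj]
  simp only [Matrix.add_apply, Matrix.sub_apply, Finset.sum_add_distrib, Finset.sum_sub_distrib,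
    sum_row_mul hw, sum_row_mul (hQ.sum_row hX)]
  simp

theorem tangentProj_w_diag (hQ : IsRangeProj X.toMatrix Q) (p : Pair n) (k : Fin n) :
    (tangentProj X (w p)).toMatrix k k =
      2 * ((Q k p.1.1 - Q k p.1.2) * (e p.1.1 k - e p.1.2 k)) - (Q k p.1.1 - Q k p.1.2) ^ 2 := by
  have hQz : ∀ l, (Q *ᵥ (e p.1.1 - e p.1.2)) l = Q l p.1.1 - Q l p.1.2 := fun l => by
    simp [mulVec_sub, e]
  have hzQ : (e p.1.1 - e p.1.2) ᵥ* Q = Q *ᵥ (e p.1.1 - e p.1.2) := by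
    rw [← mulVec_transpose, hQ.transpose_eq]
  rw [hQ.toMatrix_tangentProj, toMatrix_w, mul_vecMulVec, vecMulVec_mul, vecMulVec_mul, hzQ,
    Matrix.sub_apply, Matrix.add_apply, vecMulVec_apply, vecMulVec_apply, vecMulVec_apply, hQz,
    Pi.sub_apply]
  ring

/-- The leverage scores are controlled by the incoherence parameter. -/
theorem sq_diag_le (hQ : IsRangeProj X.toMatrix Q) (hX : X.toMatrix *ᵥ 1 = 0) {K : ℝ}
    (hinc : ∀ p : Pair n, ∑ q : Pair n, (inner ℝ (tangentProj X (w p)) (w q)) ^ 2 ≤ 2 * K / n)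
    (hn : 2 ≤ n) (i : Fin n) : (n * Q i i) ^ 2 ≤ 2 * K := by
  have hn0 : (0 : ℝ) < n := by positivity
  -- Row `i` of `Q` sums to zero and `Q i i ≥ 0`, so its off-diagonal entries cannot all be
  -- positive. For such `j`, the `i`-th diagonal entry of `P w_{ij}` is at least `Q i i`.
  obtain ⟨j, hij, hj⟩ : ∃ j, i ≠ j ∧ Q i j ≤ 0 := by
    by_contra! hcon
    have : Nontrivial (Fin n) := Fin.nontrivial_iff_two_le.2 hn
    obtain ⟨j, hj⟩ := exists_ne i
    have hpos : 0 < ∑ k, Q i k := Finset.sum_pos' (fun k _ => by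
      rcases eq_or_ne i k with rfl | h
      · exact hQ.diag_nonneg i
      · exact (hcon k h).le) ⟨j, Finset.mem_univ _, hcon j hj.symm⟩
    exact hpos.ne' (hQ.sum_row hX i)
  have hlow : Q i i ≤ 2 * (Q i i - Q i j) - (Q i i - Q i j) ^ 2 := by
    have h1 := hQ.sq_add_sq_le hij
    have h2 : 0 ≤ -Q i j * (1 - Q i i) := by
      refine mul_nonneg (by linarith) ?_
      nlinarith [hQ.diag_nonneg i, sq_nonneg (Q i j)]
    nlinarith
  obtain ⟨p, hp⟩ : ∃ p : Pair n, (tangentProj X (w p)).toMatrix i i =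
      2 * (Q i i - Q i j) - (Q i i - Q i j) ^ 2 := by
    rcases lt_or_gt_of_ne hij with h | h
    · refine ⟨⟨(i, j), h⟩, ?_⟩
      rw [hQ.tangentProj_w_diag]
      simp [e, hij]
    · refine ⟨⟨(j, i), h⟩, ?_⟩
      rw [hQ.tangentProj_w_diag]
      simp [e, hij]
      ring
  have h1 := hinc p
  rw [sum_inner_w_sq _ (hQ.sum_row_tangentProj_w hX p)] at h1
  have h2 : (tangentProj X (w p)).toMatrix i i ^ 2 ≤
      ∑ k, (tangentProj X (w p)).toMatrix k k ^ 2 :=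
    Finset.single_le_sum (f := fun k => (tangentProj X (w p)).toMatrix k k ^ 2)
      (fun k _ => sq_nonneg _) (Finset.mem_univ i)
  have h3 : Q i i ^ 2 ≤ (tangentProj X (w p)).toMatrix i i ^ 2 := by
    rw [hp]
    exact pow_le_pow_left₀ (hQ.diag_nonneg i) hlow 2
  have h4 : n * Q i i ^ 2 ≤ 2 * K / n := by
    have : n * Q i i ^ 2 ≤ n * ∑ k, (tangentProj X (w p)).toMatrix k k ^ 2 := by
      gcongr; exact h3.trans h2
    have h5 := sq_nonneg (∑ k, (tangentProj X (w p)).toMatrix k k)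
    have h6 := sq_nonneg ‖tangentProj X (w p)‖
    linarith
  rw [le_div_iff₀ hn0] at h4
  linarith

theorem norm_tangentProj_w_sq_le (hQ : IsRangeProj X.toMatrix Q) (hX : X.toMatrix *ᵥ 1 = 0) {K : ℝ}
    (hinc : ∀ p : Pair n, ∑ q : Pair n, (inner ℝ (tangentProj X (w p)) (w q)) ^ 2 ≤ 2 * K / n)
    (p : Pair n) : ‖tangentProj X (w p)‖ ^ 2 ≤ K / n := by
  have h1 := hinc p
  rw [sum_inner_w_sq _ (hQ.sum_row_tangentProj_w hX p)] at h1
  have h2 : 0 ≤ n * ∑ i, (tangentProj X (w p)).toMatrix i i ^ 2 := by positivity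
  have h3 := sq_nonneg (∑ k, (tangentProj X (w p)).toMatrix k k)
  have h4 : 2 * K / n = 2 * (K / n) := by ring
  linarith

/-- `‖P v‖² = 2 tr (Q v v) - ‖Q v Q‖²`. Because `Q J = Q`, one has `a_kᵀ Q a_l = Q k l`, and `2 |Q i
j| ≤ Q i i + Q j j` bounds the trace term by `(Q i i + Q j j) / 2`. -/
theorem norm_tangentProj_v_sq_le (hQ : IsRangeProj X.toMatrix Q) (hX : X.toMatrix *ᵥ 1 = 0) {s : ℝ}
    (hs : ∀ i, Q i i ≤ s) (p : Pair n) : ‖tangentProj X (v p)‖ ^ 2 ≤ s := by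
  obtain ⟨⟨i, j⟩, hij⟩ := p
  have hn : (1 : ℝ) ≤ n := by exact_mod_cast i.pos
  set V := (v ⟨(i, j), hij⟩).toMatrix with hV
  have hQQ : ∀ M, Q * (Q * M) = Q * M := fun M => by rw [← Matrix.mul_assoc, hQ.mul_self]
  have hle : ‖tangentProj X (v ⟨(i, j), hij⟩)‖ ^ 2 ≤ 2 * trace (Q * V * V) := by
    set S : SymMat n := SymMat.mk (Q * V * Q) (by
      rw [Matrix.IsSymm, transpose_mul, transpose_mul, (v _).isSymm.eq, hQ.transpose_eq,
        Matrix.mul_assoc])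
    have hSS : ‖S‖ ^ 2 = trace (Q * V * Q * V) := by
      rw [SymMat.norm_sq_eq_trace]
      change trace (Q * V * Q * (Q * V * Q)) = _
      rw [trace_mul_comm, Matrix.mul_assoc, trace_mul_comm]
      simp only [Matrix.mul_assoc, hQQ]
    have h1 : trace (V * Q * V) = trace (Q * V * V) := by
      rw [Matrix.mul_assoc, trace_mul_comm]
    rw [norm_tangentProj_sq, SymMat.inner_eq_trace, hQ.toMatrix_tangentProj, Matrix.sub_mul,
      Matrix.add_mul, trace_sub, trace_add, h1, ← hSS]
    linarith [sq_nonneg ‖S‖]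
  have hVa : V = -((1 / 2 : ℝ) • (vecMulVec (a i) (a j) + vecMulVec (a j) (a i))) := rfl
  have haQa : ∀ k l, a k ⬝ᵥ Q *ᵥ a l = Q k l := fun k l => by
    rw [a_dotProduct_mulVec_a, hQ.centeringMatrix_mul hX, hQ.mul_centeringMatrix hX]
  have htr : trace (Q * V * V) = (1 / 4) * (2 * Q i j * (a i ⬝ᵥ a j) +
      Q i i * (a j ⬝ᵥ a j) + Q j j * (a i ⬝ᵥ a i)) := by
    have hQV : Q * V = -((1 / 2 : ℝ) • (vecMulVec (Q *ᵥ a i) (a j) +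
        vecMulVec (Q *ᵥ a j) (a i))) := by
      rw [hVa, Matrix.mul_neg, Matrix.mul_smul, Matrix.mul_add, mul_vecMulVec, mul_vecMulVec]
    rw [hQV, hVa]
    simp only [Matrix.mul_neg, Matrix.neg_mul, Matrix.mul_smul, Matrix.smul_mul,
      trace_neg, trace_smul, smul_eq_mul, Matrix.mul_add, Matrix.add_mul,
      vecMulVec_mul_vecMulVec, trace_add, trace_vecMulVec, smul_dotProduct,
      dotProduct_comm (Q *ᵥ a _), haQa, hQ.apply_comm j i, dotProduct_comm (a j) (a i)]
    ring
  rw [a_dotProduct_a, a_dotProduct_a, a_dotProduct_a, if_neg hij.ne, if_pos rfl, if_pos rfl] at htr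
  have h1 := hQ.two_mul_abs_le i j
  have h2 := neg_abs_le (Q i j)
  have hinv : 0 < 1 / (n : ℝ) := by positivity
  have hinv1 : 1 / (n : ℝ) ≤ 1 := by rw [div_le_one (by positivity)]; exact hn
  have h3 : -(2 * Q i j) * (1 / (n : ℝ)) ≤ (Q i i + Q j j) * (1 / (n : ℝ)) := by
    gcongr; linarith
  have h4 := hs i
  have h5 := hs j
  linarith

/-- Centering `P Y` does not change its pairings with `w`, keeps it tangent, and makes its row sums
zero, so the energy identity and the diagonal bound both apply. -/
theorem sum_inner_tangentProj_w_sq_le (hQ : IsRangeProj X.toMatrix Q) (hX : X.toMatrix *ᵥ 1 = 0)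
    {s : ℝ} (hs : ∀ i, Q i i ≤ s) (hs0 : 0 ≤ s) (Y : SymMat n) :
    ∑ p : Pair n, inner ℝ (tangentProj X Y) (w p) ^ 2 ≤ (4 * n * s + 2) * ‖Y‖ ^ 2 := by
  have h1 := sum_inner_w_sq_le (centering (tangentProj X Y)) (sum_row_centering _)
  simp only [inner_centering_w] at h1
  have h2 := hQ.sum_diag_sq_le hs hs0 (hQ.tangentProj_centering_tangentProj hX Y)
  have h3 : ‖centering (tangentProj X Y)‖ ^ 2 ≤ ‖Y‖ ^ 2 := by
    gcongr
    exact (norm_centering_le _).trans (norm_tangentProj_le X Y)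
  calc _ ≤ 2 * n * ∑ i, (centering (tangentProj X Y)).toMatrix i i ^ 2 +
        2 * ‖centering (tangentProj X Y)‖ ^ 2 := h1
    _ ≤ 2 * n * (2 * s * ‖centering (tangentProj X Y)‖ ^ 2) +
        2 * ‖centering (tangentProj X Y)‖ ^ 2 := by gcongr
    _ = (4 * n * s + 2) * ‖centering (tangentProj X Y)‖ ^ 2 := by ring
    _ ≤ _ := by gcongr

end IsRangeProj

end EDG

/-! ### Sampling probabilities and the centered summands. -/

theorem measureReal_iid_uniform {κ S : Type*} [Fintype κ] [MeasurableSpace κ]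
    [MeasurableSingletonClass κ] [MeasurableSpace S] {μ : Measure S} [IsProbabilityMeasure μ]
    {m : ℕ} {α : Fin m → S → κ} (hmeas : ∀ k, Measurable (α k)) (hindep : iIndepFun α μ)
    (hunif : ∀ k, μ.map (α k) = uniformOn Set.univ) (A : Set (Fin m → κ)) :
    μ.real {s | (fun k => α k s) ∈ A} = A.ncard / (Fintype.card κ : ℝ) ^ m := by
  classical
  have hm : Measurable fun s k => α k s := measurable_pi_lambda _ hmeas
  have hpi : μ.map (fun s k => α k s) = Measure.pi fun k => μ.map (α k) :=
    (iIndepFun_iff_map_fun_eq_pi_map fun k => (hmeas k).aemeasurable).1 hindep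
  have hprob : ∀ k, IsProbabilityMeasure (μ.map (α k)) := fun k =>
    Measure.isProbabilityMeasure_map (hmeas k).aemeasurable
  have hone : ∀ k x, (μ.map (α k)).real {x} = (Fintype.card κ : ℝ)⁻¹ := fun k x => by
    rw [hunif, measureReal_def, uniformOn_univ]
    simp
  have h1 : μ.real {s | (fun k => α k s) ∈ A} = (μ.map fun s k => α k s).real A := by
    rw [map_measureReal_apply hm (Set.toFinite A).measurableSet]
    rfl
  rw [h1, hpi, ← Set.coe_toFinset A, ← sum_measureReal_singleton]
  have h2 : ∀ x, (Measure.pi fun k => μ.map (α k)).real {x} = ((Fintype.card κ : ℝ) ^ m)⁻¹ :=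
    fun x => by
    rw [measureReal_def, Measure.pi_singleton, ENNReal.toReal_prod]
    simp only [← measureReal_def, hone]
    simp
  simp only [h2]
  rw [Finset.sum_const, Set.ncard_coe_finset, nsmul_eq_mul, div_eq_mul_inv]

/-- Variance is at most the second moment, `c` being the mean of `y`. -/
theorem sum_norm_sub_sq_le {E ι : Type*} [NormedAddCommGroup E] [InnerProductSpace ℝ E]
    [Fintype ι] (y : ι → E) (c : E) (h : ∑ i, y i = (Fintype.card ι : ℝ) • c) :
    ∑ i, ‖y i - c‖ ^ 2 ≤ ∑ i, ‖y i‖ ^ 2 := by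
  simp only [norm_sub_sq_real, Finset.sum_add_distrib, Finset.sum_sub_distrib, ← Finset.mul_sum,
    ← sum_inner, h]
  rw [real_inner_smul_left, real_inner_self_eq_norm_sq]
  simp
  nlinarith [mul_nonneg (Nat.cast_nonneg (α := ℝ) (Fintype.card ι)) (sq_nonneg ‖c‖)]

namespace EDG

variable {n : ℕ}

/-- The compression of `X ↦ ⟨X, w_α⟩ v_α` to the tangent space at `X₀`. -/
def compressedTerm (X₀ : SymMat n) (p : Pair n) : SymMat n →L[ℝ] SymMat n :=
  tangentProj X₀ ∘L (innerSL ℝ (w p)).smulRight (v p) ∘L tangentProj X₀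

/-- The compression of the centering map to the tangent space at `X₀`. -/
def compressedCentering (X₀ : SymMat n) : SymMat n →L[ℝ] SymMat n :=
  tangentProj X₀ ∘L centering ∘L tangentProj X₀

/-- The centered summands of `P Q P - P`, up to normalization. -/
def deviationTerm (X₀ : SymMat n) (p : Pair n) : SymMat n →L[ℝ] SymMat n :=
  numPairs n • compressedTerm X₀ p - compressedCentering X₀

variable {X₀ : SymMat n}

theorem compressedTerm_apply (p : Pair n) (Y : SymMat n) : compressedTerm X₀ p Y =
    inner ℝ (tangentProj X₀ Y) (w p) • tangentProj X₀ (v p) := by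
  simp [compressedTerm, real_inner_comm]

theorem star_compressedTerm_apply (p : Pair n) (Y : SymMat n) : star (compressedTerm X₀ p) Y =
    inner ℝ (tangentProj X₀ Y) (v p) • tangentProj X₀ (w p) := by
  refine ext_inner_left ℝ fun Z => ?_
  rw [TraceInequality.inner_star_apply, compressedTerm_apply, real_inner_smul_left,
    real_inner_smul_right, inner_tangentProj_left X₀ Z, inner_tangentProj_left X₀ Y,
    real_inner_comm Y, mul_comm]

theorem sum_compressedTerm_apply (Y : SymMat n) :
    ∑ p, compressedTerm X₀ p Y = compressedCentering X₀ Y := by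
  simp [compressedTerm, compressedCentering, centering]

theorem sum_compressedTerm :
    ∑ p, compressedTerm X₀ p = compressedCentering X₀ := by
  ext1 Y
  rw [_root_.sum_apply, sum_compressedTerm_apply]

theorem deviationTerm_apply (p : Pair n) (Y : SymMat n) : deviationTerm X₀ p Y =
    numPairs n • compressedTerm X₀ p Y - compressedCentering X₀ Y := rfl

theorem sum_deviationTerm_apply {ι : Type*} [Fintype ι] (α : ι → Pair n) (Y : SymMat n) :
    ∑ k, deviationTerm X₀ (α k) Y = numPairs n • ∑ k, compressedTerm X₀ (α k) Y -
      (Fintype.card ι : ℝ) • compressedCentering X₀ Y := by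
  simp only [deviationTerm_apply, Finset.sum_sub_distrib, ← Finset.smul_sum]
  rw [Finset.sum_const, Finset.card_univ, ← Nat.cast_smul_eq_nsmul ℝ]

theorem sum_deviationTerm : ∑ p, deviationTerm X₀ p = 0 := by
  ext1 Y
  rw [_root_.sum_apply, sum_deviationTerm_apply fun p => p, sum_compressedTerm_apply, card_pair,
    sub_self]
  rfl

theorem norm_compressedCentering_le : ‖compressedCentering X₀‖ ≤ 1 := by
  refine ContinuousLinearMap.opNorm_le_bound _ zero_le_one fun Y => ?_
  rw [one_mul]
  exact (norm_tangentProj_le _ _).trans ((norm_centering_le _).trans (norm_tangentProj_le _ _))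

theorem tangentProj_samplingOp_tangentProj_sub {m : ℕ} (hm : 0 < m) (α : Fin m → Pair n) :
    tangentProj X₀ ∘L samplingOp α ∘L tangentProj X₀ - tangentProj X₀ =
      (m : ℝ)⁻¹ • ∑ k, deviationTerm X₀ (α k) := by
  have hm0 : (m : ℝ) ≠ 0 := by positivity
  ext1 Y
  -- Duality of the bases rewrites the subtracted `P` as compressed centering plus compressed
  -- diagonal part; the latter cancels the deterministic part of the sampling operator.
  have hI := DFunLike.congr_fun (centering_add_sum_wDiag_vDiag (n := n)) (tangentProj X₀ Y)
  simp only [_root_.add_apply, ContinuousLinearMap.id_apply] at hI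
  have hI' := congrArg (tangentProj X₀) hI
  rw [tangentProj_tangentProj, map_add] at hI'
  have h1 : ((m : ℝ)⁻¹ • ∑ k, deviationTerm X₀ (α k)) Y =
      (numPairs n / m) • ∑ k, compressedTerm X₀ (α k) Y - compressedCentering X₀ Y := by
    change (m : ℝ)⁻¹ • (∑ k, deviationTerm X₀ (α k)) Y = _
    rw [_root_.sum_apply, sum_deviationTerm_apply, Fintype.card_fin, smul_sub,
      smul_smul, smul_smul, inv_mul_cancel₀ hm0, one_smul, inv_mul_eq_div]
  rw [h1]
  simp only [_root_.sub_apply, ContinuousLinearMap.comp_apply, samplingOp, _root_.add_apply,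
    _root_.smul_apply, map_add, map_smul]
  refine (congrArg (fun z => _ - z) hI'.symm).trans ?_
  simp only [compressedTerm, compressedCentering, ContinuousLinearMap.comp_apply, _root_.sum_apply,
    map_sum]
  abel

theorem adjoint_compress_sub (T : SymMat n →L[ℝ] SymMat n) :
    tangentProj X₀ ∘L ContinuousLinearMap.adjoint T ∘L tangentProj X₀ - tangentProj X₀ =
      ContinuousLinearMap.adjoint (tangentProj X₀ ∘L T ∘L tangentProj X₀ - tangentProj X₀) := by
  refine ContinuousLinearMap.ext fun Y => ext_inner_left ℝ fun Z => ?_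
  rw [ContinuousLinearMap.adjoint_inner_right]
  simp only [_root_.sub_apply, ContinuousLinearMap.comp_apply, inner_sub_left, inner_sub_right,
    inner_tangentProj_left]
  rw [← inner_tangentProj_left, ContinuousLinearMap.adjoint_inner_right]

theorem numPairs_nonneg : 0 ≤ numPairs n := by rw [← card_pair]; positivity

theorem numPairs_le : numPairs n ≤ n ^ 2 / 2 := by
  rw [numPairs]
  nlinarith [Nat.cast_nonneg (α := ℝ) n]

theorem sum_norm_deviationTerm_sq_le (Y : SymMat n) :
    ∑ p, ‖deviationTerm X₀ p Y‖ ^ 2 ≤ numPairs n ^ 2 * ∑ p, ‖compressedTerm X₀ p Y‖ ^ 2 := by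
  refine (sum_norm_sub_sq_le (fun p => numPairs n • compressedTerm X₀ p Y)
    (compressedCentering X₀ Y) ?_).trans (le_of_eq ?_)
  · rw [← Finset.smul_sum, sum_compressedTerm_apply, card_pair]
  · rw [Finset.mul_sum]
    simp only [norm_smul, mul_pow, Real.norm_eq_abs, sq_abs]

theorem star_deviationTerm_apply (p : Pair n) (Y : SymMat n) : star (deviationTerm X₀ p) Y =
    numPairs n • star (compressedTerm X₀ p) Y - star (compressedCentering X₀) Y := by
  refine ext_inner_left ℝ fun Z => ?_
  rw [inner_sub_right, real_inner_smul_right, TraceInequality.inner_star_apply,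
    TraceInequality.inner_star_apply, TraceInequality.inner_star_apply, deviationTerm_apply,
    inner_sub_left, real_inner_smul_left]

theorem sum_norm_star_deviationTerm_sq_le (Y : SymMat n) : ∑ p, ‖star (deviationTerm X₀ p) Y‖ ^ 2 ≤
    numPairs n ^ 2 * ∑ p, ‖star (compressedTerm X₀ p) Y‖ ^ 2 := by
  simp only [star_deviationTerm_apply]
  refine (sum_norm_sub_sq_le (fun p => numPairs n • star (compressedTerm X₀ p) Y)
    (star (compressedCentering X₀) Y) ?_).trans (le_of_eq ?_)
  · rw [← Finset.smul_sum, ← _root_.sum_apply, ← star_sum, sum_compressedTerm, card_pair]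
  · rw [Finset.mul_sum]
    simp only [norm_smul, mul_pow, Real.norm_eq_abs, sq_abs]

/-! ### Norm and variance bounds for the summands. -/

section Bounds

variable {Q : Matrix (Fin n) (Fin n) ℝ} {K : ℝ}

theorem leverage_le (hQ : IsRangeProj X₀.toMatrix Q) (hX : X₀.toMatrix *ᵥ 1 = 0)
    (hinc : ∀ p : Pair n, ∑ q : Pair n, (inner ℝ (tangentProj X₀ (w p)) (w q)) ^ 2 ≤ 2 * K / n)
    (hn : 2 ≤ n) (i : Fin n) : Q i i ≤ √(2 * K) / n := by
  have hn0 : (0 : ℝ) < n := by positivity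
  rw [le_div_iff₀ hn0, mul_comm]
  exact Real.le_sqrt_of_sq_le (hQ.sq_diag_le hX hinc hn i)

/-- `1 ≤ rank = tr Q ≤ √(2 K)`. This lower bound on `K` absorbs the additive constants below. -/
theorem one_le_two_mul_incoherence (hQ : IsRangeProj X₀.toMatrix Q) (hX : X₀.toMatrix *ᵥ 1 = 0)
    (hinc : ∀ p : Pair n, ∑ q : Pair n, (inner ℝ (tangentProj X₀ (w p)) (w q)) ^ 2 ≤ 2 * K / n)
    (hn : 2 ≤ n) (hr : 1 ≤ X₀.toMatrix.rank) : 1 ≤ 2 * K := by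
  have hn0 : (0 : ℝ) < n := by positivity
  have h1 : (1 : ℝ) ≤ trace Q := by rw [hQ.trace_eq]; exact_mod_cast hr
  have h2 : trace Q ≤ √(2 * K) := by
    calc trace Q ≤ ∑ _i : Fin n, √(2 * K) / n :=
          Finset.sum_le_sum fun i _ => leverage_le hQ hX hinc hn i
      _ = √(2 * K) := by simp; field_simp
  have h3 := Real.one_le_sqrt.1 (h1.trans h2)
  exact h3

/-- `‖P v‖² ≤ s` and the `w`-energy is at most `6 n s ‖Y‖²`, using `n s ≥ 1`. Then `L ≤ n² / 2` and
`n² s² = 2 K` give the constant `6 K n`. -/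
theorem sum_norm_deviationTerm_sq_le_incoherence
    (hQ : IsRangeProj X₀.toMatrix Q) (hX : X₀.toMatrix *ᵥ 1 = 0)
    (hinc : ∀ p : Pair n, ∑ q : Pair n, (inner ℝ (tangentProj X₀ (w p)) (w q)) ^ 2 ≤ 2 * K / n)
    (hn : 2 ≤ n) (hK : 1 ≤ 2 * K) (Y : SymMat n) :
    ∑ p, ‖deviationTerm X₀ p Y‖ ^ 2 ≤
      Fintype.card (Pair n) * (6 * (K * n)) * ‖Y‖ ^ 2 := by
  have hn0 : (0 : ℝ) < n := by positivity
  have hs := leverage_le hQ hX hinc hn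
  set s := √(2 * K) / n with hs_def
  have hs0 : 0 ≤ s := by positivity
  have hns : 1 ≤ n * s := by
    rw [hs_def, mul_div_cancel₀ _ hn0.ne']
    exact Real.one_le_sqrt.2 hK
  have hs2 : n ^ 2 * s ^ 2 = 2 * K := by
    rw [hs_def, div_pow, Real.sq_sqrt (by linarith)]
    field_simp
  have h1 : ∑ p, ‖compressedTerm X₀ p Y‖ ^ 2 ≤ s * ((6 * (n * s)) * ‖Y‖ ^ 2) := by
    calc ∑ p, ‖compressedTerm X₀ p Y‖ ^ 2 ≤
          ∑ p : Pair n, s * inner ℝ (tangentProj X₀ Y) (w p) ^ 2 := by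
            refine Finset.sum_le_sum fun p _ => ?_
            rw [compressedTerm_apply, norm_smul, mul_pow, Real.norm_eq_abs, sq_abs, mul_comm]
            gcongr
            exact hQ.norm_tangentProj_v_sq_le hX hs p
      _ ≤ s * ((4 * n * s + 2) * ‖Y‖ ^ 2) := by
            rw [← Finset.mul_sum]
            gcongr
            exact hQ.sum_inner_tangentProj_w_sq_le hX hs hs0 Y
      _ ≤ _ := by gcongr; linarith
  rw [card_pair]
  calc _ ≤ numPairs n ^ 2 * ∑ p, ‖compressedTerm X₀ p Y‖ ^ 2 := sum_norm_deviationTerm_sq_le Y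
    _ ≤ numPairs n ^ 2 * (s * ((6 * (n * s)) * ‖Y‖ ^ 2)) := by gcongr
    _ = numPairs n * (numPairs n * (6 * (n * s ^ 2))) * ‖Y‖ ^ 2 := by ring
    _ ≤ numPairs n * (n ^ 2 / 2 * (6 * (n * s ^ 2))) * ‖Y‖ ^ 2 := by
      have := numPairs_nonneg (n := n)
      gcongr
      exact numPairs_le
    _ = numPairs n * (3 * (n ^ 2 * s ^ 2) * n) * ‖Y‖ ^ 2 := by ring
    _ = _ := by rw [hs2]; ring

/-- The adjoint swaps `v` and `w`: now `‖P w‖² ≤ K / n` meets a `v`-energy of at most `‖Y‖² / 2`.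
This yields `K n / 4`, relaxed to match the other variance. -/
theorem sum_norm_star_deviationTerm_sq_le_incoherence
    (hQ : IsRangeProj X₀.toMatrix Q) (hX : X₀.toMatrix *ᵥ 1 = 0)
    (hinc : ∀ p : Pair n, ∑ q : Pair n, (inner ℝ (tangentProj X₀ (w p)) (w q)) ^ 2 ≤ 2 * K / n)
    (hn : 2 ≤ n) (hK : 1 ≤ 2 * K) (Y : SymMat n) :
    ∑ p, ‖star (deviationTerm X₀ p) Y‖ ^ 2 ≤
      Fintype.card (Pair n) * (6 * (K * n)) * ‖Y‖ ^ 2 := by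
  have hn0 : (0 : ℝ) < n := by positivity
  have hK0 : 0 < K := by linarith
  have h1 : ∑ p, ‖star (compressedTerm X₀ p) Y‖ ^ 2 ≤ K / n * (‖Y‖ ^ 2 / 2) := by
    calc ∑ p, ‖star (compressedTerm X₀ p) Y‖ ^ 2 ≤
          ∑ p : Pair n, K / n * inner ℝ (tangentProj X₀ Y) (v p) ^ 2 := by
            refine Finset.sum_le_sum fun p _ => ?_
            rw [star_compressedTerm_apply, norm_smul, mul_pow, Real.norm_eq_abs, sq_abs, mul_comm]
            gcongr
            exact hQ.norm_tangentProj_w_sq_le hX hinc p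
      _ ≤ K / n * (‖tangentProj X₀ Y‖ ^ 2 / 2) := by
            rw [← Finset.mul_sum]
            gcongr
            exact sum_inner_v_sq_le _
      _ ≤ _ := by gcongr; exact norm_tangentProj_le _ _
  rw [card_pair]
  have hL := numPairs_nonneg (n := n)
  calc _ ≤ numPairs n ^ 2 * ∑ p, ‖star (compressedTerm X₀ p) Y‖ ^ 2 :=
        sum_norm_star_deviationTerm_sq_le Y
    _ ≤ numPairs n ^ 2 * (K / n * (‖Y‖ ^ 2 / 2)) := by gcongr
    _ = numPairs n * (numPairs n * (K / n / 2)) * ‖Y‖ ^ 2 := by ring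
    _ ≤ numPairs n * (n ^ 2 / 2 * (K / n / 2)) * ‖Y‖ ^ 2 := by
      gcongr
      exact numPairs_le
    _ = numPairs n * (K * n / 4) * ‖Y‖ ^ 2 := by field_simp; ring
    _ ≤ _ := by
      gcongr
      nlinarith [mul_pos hK0 hn0]

theorem norm_deviationTerm_le
    (hQ : IsRangeProj X₀.toMatrix Q) (hX : X₀.toMatrix *ᵥ 1 = 0)
    (hinc : ∀ p : Pair n, ∑ q : Pair n, (inner ℝ (tangentProj X₀ (w p)) (w q)) ^ 2 ≤ 2 * K / n)
    (hn : 2 ≤ n) (hK : 1 ≤ 2 * K) (p : Pair n) : ‖deviationTerm X₀ p‖ ≤ 2 * (K * n) := by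
  have hn0 : (0 : ℝ) < n := by positivity
  have hn2 : (2 : ℝ) ≤ n := by exact_mod_cast hn
  have hK0 : 0 < K := by linarith
  have hw := hQ.norm_tangentProj_w_sq_le hX hinc p
  -- `√(2 K) ≤ 2 K` because `2 K ≥ 1`.
  have hv : ‖tangentProj X₀ (v p)‖ ^ 2 ≤ 2 * K / n := by
    refine (hQ.norm_tangentProj_v_sq_le hX (leverage_le hQ hX hinc hn) p).trans ?_
    gcongr
    rw [Real.sqrt_le_left (by linarith)]
    nlinarith
  have hL := numPairs_nonneg (n := n)
  have hterm : ‖compressedTerm X₀ p‖ ≤ ‖tangentProj X₀ (w p)‖ * ‖tangentProj X₀ (v p)‖ := by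
    refine ContinuousLinearMap.opNorm_le_bound _ (by positivity) fun Y => ?_
    rw [compressedTerm_apply, norm_smul, inner_tangentProj_left]
    calc _ ≤ ‖Y‖ * ‖tangentProj X₀ (w p)‖ * ‖tangentProj X₀ (v p)‖ := by
          gcongr; exact norm_inner_le_norm _ _
      _ = _ := by ring
  have hprod : numPairs n * (‖tangentProj X₀ (w p)‖ * ‖tangentProj X₀ (v p)‖) ≤ K * n := by
    refine le_of_sq_le_sq ?_ (by positivity)
    calc _ = numPairs n ^ 2 * (‖tangentProj X₀ (w p)‖ ^ 2 * ‖tangentProj X₀ (v p)‖ ^ 2) := by ring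
      _ ≤ (n ^ 2 / 2) ^ 2 * (K / n * (2 * K / n)) := by gcongr; exact numPairs_le
      _ = (K * n) ^ 2 / 2 := by field_simp
      _ ≤ _ := by linarith [sq_nonneg (K * n)]
  calc ‖deviationTerm X₀ p‖ ≤ numPairs n * ‖compressedTerm X₀ p‖ + ‖compressedCentering X₀‖ := by
        refine ContinuousLinearMap.opNorm_le_bound _ (by positivity) fun Y => ?_
        rw [deviationTerm_apply, add_mul, mul_assoc]
        refine (norm_sub_le _ _).trans (add_le_add ?_ (ContinuousLinearMap.le_opNorm _ _))
        rw [norm_smul, Real.norm_of_nonneg hL]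
        gcongr
        exact ContinuousLinearMap.le_opNorm _ _
    _ ≤ numPairs n * (‖tangentProj X₀ (w p)‖ * ‖tangentProj X₀ (v p)‖) + 1 := by
        gcongr
        exact norm_compressedCentering_le
    _ ≤ K * n + 1 := by gcongr
    _ ≤ _ := by nlinarith

end Bounds

end EDG

/-! ### Choice of parameters and conclusion. -/

namespace EDG

variable {n : ℕ} {X₀ : SymMat n}

theorem tangentProj_eq_zero_of_rank_eq_zero (h : X₀.toMatrix.rank = 0) : tangentProj X₀ = 0 := by
  have hX : X₀.toMatrix = 0 := by
    rw [Matrix.rank, Submodule.finrank_eq_zero, LinearMap.range_eq_bot] at h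
    ext i j
    simpa using congrFun (LinearMap.congr_fun h (Pi.single j 1)) i
  have hT : tangentSpace X₀ = ⊥ := by
    rw [tangentSpace, LinearMap.range_eq_bot]
    ext1 Z
    apply SymMat.toMatrix_injective
    change Z * X₀.toMatrix + X₀.toMatrix * Zᵀ = 0
    simp [hX]
  rw [tangentProj]
  simp only [hT]
  exact Submodule.starProjection_bot

/-- For `ε ≤ 1 / 2` the inner exponential is at most `exp (1 / 7) ≤ 6 / 5`. The exponent is then at
most `(18 / 5 - 7) / 49 = -17 / 245` times `m ε² / N`, and `m ε² / N ≥ 49 ℓ` gives `-17 ℓ / 5`. -/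
theorem sampling_exponent_le {ε N ℓ m : ℝ} (hε : 0 < ε) (hε' : ε ≤ 1 / 2) (hN : 0 < N)
    (hℓ : 0 ≤ ℓ) (hm : 49 / ε ^ 2 * N * ℓ ≤ m) :
    m * ((ε / (7 * N)) ^ 2 * (6 * N) * Real.exp (ε / (7 * N) * (2 * N)) / 2) -
      ε / (7 * N) * (ε * m) ≤ -(3 * ℓ) := by
  have hexp : Real.exp (ε / (7 * N) * (2 * N)) ≤ 6 / 5 := by
    have h1 : ε / (7 * N) * (2 * N) ≤ 1 / 7 := by
      have : ε / (7 * N) * (2 * N) = 2 / 7 * ε := by field_simp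
      linarith
    have h2 := Real.add_one_le_exp (-(ε / (7 * N) * (2 * N)))
    rw [Real.exp_neg] at h2
    have h3 : 6 / 7 ≤ (Real.exp (ε / (7 * N) * (2 * N)))⁻¹ := by linarith
    rw [le_inv_comm₀ (by norm_num) (Real.exp_pos _)] at h3
    linarith
  have hm0 : 0 ≤ m := le_trans (by positivity) hm
  have hmε : 49 * ℓ ≤ m * (ε ^ 2 / N) := by
    calc 49 * ℓ = 49 / ε ^ 2 * N * ℓ * (ε ^ 2 / N) := by field_simp
      _ ≤ _ := by gcongr
  calc _ ≤ m * ((ε / (7 * N)) ^ 2 * (6 * N) * (6 / 5) / 2) - ε / (7 * N) * (ε * m) := by gcongr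
    _ = -(17 / 245 * (m * (ε ^ 2 / N))) := by field_simp; ring
    _ ≤ _ := by linarith

/-- Tail bound for the deviation of the compressed sampling operator. -/
theorem ncard_deviation_le {m : ℕ} {ε K : ℝ} (hε : 0 < ε) (hε' : ε ≤ 1 / 2)
    (hX : X₀.toMatrix *ᵥ 1 = 0)
    (hinc : ∀ p : Pair n, ∑ q : Pair n, (inner ℝ (tangentProj X₀ (w p)) (w q)) ^ 2 ≤ 2 * K / n)
    (hn : 2 ≤ n) (hK : 1 ≤ 2 * K) (hm : 49 / ε ^ 2 * (K * n) * Real.log n ≤ m) :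
    {α : Fin m → Pair n | ε * m < ‖∑ k, deviationTerm X₀ (α k)‖}.ncard ≤
      (Fintype.card (Pair n) : ℝ) ^ m * (2 / n) := by
  obtain ⟨Q, hQ⟩ := exists_isRangeProj X₀.isSymm
  have hn0 : (0 : ℝ) < n := by positivity
  have hN : 0 < K * n := mul_pos (by linarith) hn0
  have : Nontrivial (SymMat n) := by
    refine ⟨SymMat.mk 1 Matrix.isSymm_one, 0, fun h => ?_⟩
    have h1 := congrArg SymMat.toMatrix h
    rw [SymMat.toMatrix_mk, map_zero] at h1
    have h2 := congrFun (congrFun h1 ⟨0, by lia⟩) ⟨0, by lia⟩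
    simp at h2
  have key := TraceInequality.card_norm_sum_gt_mul_exp_le (B := deviationTerm X₀)
    sum_deviationTerm (R := 2 * (K * n)) (V := 6 * (K * n)) (θ := ε / (7 * (K * n))) (t := ε * m)
    (by positivity) (by positivity) (norm_deviationTerm_le hQ hX hinc hn hK)
    (sum_norm_deviationTerm_sq_le_incoherence hQ hX hinc hn hK)
    (sum_norm_star_deviationTerm_sq_le_incoherence hQ hX hinc hn hK) m
  have hexp := sampling_exponent_le hε hε' hN (Real.log_natCast_nonneg n) hm
  rw [mul_pow, ← Real.exp_nat_mul, ← le_div_iff₀ (Real.exp_pos _)] at key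
  refine key.trans ?_
  have hdim : (Module.finrank ℝ (SymMat n) : ℝ) ≤ n ^ 2 := by
    exact_mod_cast SymMat.finrank_le n
  have hlog : Real.exp (-(3 * Real.log n)) = ((n : ℝ) ^ 3)⁻¹ := by
    rw [Real.exp_neg, ← Real.log_rpow hn0, Real.exp_log (by positivity)]
    norm_cast
  set κ : ℝ := (Fintype.card (Pair n) : ℝ) ^ m
  have hκ : 0 ≤ κ := by positivity
  set u := (m : ℝ) * ((ε / (7 * (K * n))) ^ 2 * (6 * (K * n)) *
    Real.exp (ε / (7 * (K * n)) * (2 * (K * n))) / 2)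
  calc κ * Real.exp u * (2 * Module.finrank ℝ (SymMat n)) / Real.exp (ε / (7 * (K * n)) * (ε * m))
      = κ * (2 * Module.finrank ℝ (SymMat n)) * Real.exp (u - ε / (7 * (K * n)) * (ε * m)) := by
        rw [Real.exp_sub]; ring
    _ ≤ κ * (2 * n ^ 2) * Real.exp (-(3 * Real.log n)) := by gcongr
    _ = κ * (2 / n) := by rw [hlog]; field_simp

end EDG

end

theorem mainTheorem2 {n m r : ℕ} {ε ν : ℝ} (hε : 0 < ε) (hε' : ε ≤ 1 / 2)
    (X₀ : SymMat n) (hrank : X₀.toMatrix.rank = r)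
    (hcentered : X₀.toMatrix.mulVec 1 = 0)
    (hν : EDG.IsIncoherent X₀ ν)
    (hm : (m : ℝ) ≥ 49 / ε ^ 2 * ν * n * r * Real.log n)
    {S : Type*} [MeasurableSpace S] (μ : Measure S) [IsProbabilityMeasure μ]
    (α : Fin m → S → EDG.Pair n)
    (hmeas : ∀ k, Measurable (α k))
    (hindep : iIndepFun α μ)
    (hunif : ∀ k, μ.map (α k) = uniformOn Set.univ) :
    μ.real {s | ‖EDG.tangentProj X₀ ∘L EDG.samplingOp (fun k => α k s) ∘L EDG.tangentProj X₀
          - EDG.tangentProj X₀‖ ≤ ε ∧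
        ‖EDG.tangentProj X₀ ∘L ContinuousLinearMap.adjoint (EDG.samplingOp (fun k => α k s)) ∘L
          EDG.tangentProj X₀ - EDG.tangentProj X₀‖ ≤ ε} ≥ 1 - 2 / (n : ℝ) := by
  -- The second deviation is the adjoint of the first, so the two norm conditions coincide.
  simp only [EDG.adjoint_compress_sub, LinearIsometryEquiv.norm_map, and_self]
  by_cases hP : EDG.tangentProj X₀ = 0
  · have h0 : ∀ T : SymMat n →L[ℝ] SymMat n,
        ‖EDG.tangentProj X₀ ∘L T ∘L EDG.tangentProj X₀ - EDG.tangentProj X₀‖ ≤ ε := fun T => by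
      refine ContinuousLinearMap.opNorm_le_bound _ hε.le fun Y => ?_
      have : (EDG.tangentProj X₀ ∘L T ∘L EDG.tangentProj X₀ - EDG.tangentProj X₀) Y = 0 := by
        simp [hP]
      rw [this, norm_zero]
      positivity
    have huniv : {s | ‖EDG.tangentProj X₀ ∘L EDG.samplingOp (fun k => α k s) ∘L
        EDG.tangentProj X₀ - EDG.tangentProj X₀‖ ≤ ε} = Set.univ :=
      Set.eq_univ_of_forall fun s => h0 _
    rw [huniv, probReal_univ, ge_iff_le, sub_le_self_iff]
    positivity
  have hn0 : n ≠ 0 := by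
    rintro rfl
    refine hP (ContinuousLinearMap.ext fun Y => SymMat.toMatrix_injective ?_)
    ext i
    exact i.elim0
  have hr : 1 ≤ X₀.toMatrix.rank := by
    by_contra! h
    exact hP (EDG.tangentProj_eq_zero_of_rank_eq_zero (by lia))
  rcases Nat.lt_or_ge n 2 with hn | hn
  -- For `n = 1` the claimed probability bound is `-1`.
  · obtain rfl : n = 1 := by lia
    exact le_trans (by norm_num) measureReal_nonneg
  have hinc : ∀ p : EDG.Pair n, ∑ q : EDG.Pair n,
      (inner ℝ (EDG.tangentProj X₀ (EDG.w p)) (EDG.w q)) ^ 2 ≤ 2 * (ν * r) / n := fun p => by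
    rw [← mul_assoc, ← hrank]; exact hν.1 p
  obtain ⟨Q, hQ⟩ := EDG.exists_isRangeProj X₀.isSymm
  have hK := EDG.one_le_two_mul_incoherence hQ hcentered hinc hn hr
  have hm' : 49 / ε ^ 2 * (ν * r * n) * Real.log n ≤ m := by
    refine le_trans (le_of_eq ?_) hm
    ring
  -- Positivity of `m` follows from the sample-size assumption since `ν r > 0` and `log n > 0`; it
  -- excludes the default value `L / 0 = 0`.
  have hmpos : (0 : ℝ) < m := by
    have h1 : (1 : ℝ) < n := by exact_mod_cast hn
    have h2 := Real.log_pos h1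
    have h3 : 0 < ν * r := by linarith
    exact lt_of_lt_of_le (by positivity) hm'
  have hmpos' : 0 < m := by exact_mod_cast hmpos
  simp only [EDG.tangentProj_samplingOp_tangentProj_sub hmpos']
  set A := {α : Fin m → EDG.Pair n | ε * m < ‖∑ k, EDG.deviationTerm X₀ (α k)‖}
  have hcard : (0 : ℝ) < Fintype.card (EDG.Pair n) := by
    have : Nonempty (EDG.Pair n) := ⟨⟨(⟨0, by lia⟩, ⟨1, by lia⟩), by simp⟩⟩
    exact_mod_cast Fintype.card_pos
  have hbad : μ.real {s | (fun k => α k s) ∈ A} ≤ 2 / n := by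
    rw [measureReal_iid_uniform hmeas hindep hunif, div_le_iff₀ (by positivity), mul_comm]
    exact EDG.ncard_deviation_le hε hε' hcentered hinc hn hK hm'
  have hcover : (Set.univ : Set S) ⊆
      {s | ‖(m : ℝ)⁻¹ • ∑ k, EDG.deviationTerm X₀ (α k s)‖ ≤ ε} ∪ {s | (fun k => α k s) ∈ A} := by
    intro s _
    by_cases hs : (fun k => α k s) ∈ A
    · exact Or.inr hs
    · refine Or.inl (ContinuousLinearMap.opNorm_le_bound _ hε.le fun Y => ?_)
      change ‖(m : ℝ)⁻¹ • (∑ k, EDG.deviationTerm X₀ (α k s)) Y‖ ≤ _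
      have h1 : ‖∑ k, EDG.deviationTerm X₀ (α k s)‖ ≤ ε * m := not_lt.1 hs
      rw [norm_smul, norm_inv, Real.norm_natCast, inv_mul_le_iff₀ hmpos]
      calc _ ≤ ‖∑ k, EDG.deviationTerm X₀ (α k s)‖ * ‖Y‖ := ContinuousLinearMap.le_opNorm _ _
        _ ≤ ε * m * ‖Y‖ := by gcongr
        _ = _ := by ring
  have h1 := (measureReal_mono (μ := μ) hcover).trans (measureReal_union_le _ _)
  rw [probReal_univ] at h1
  linarith
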